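/- Let $d \neq 1$ be a squarefree integer, let $\Delta = d$ if $d \equiv 1 \bmod 4$ and $\Delta = 4d$ if $d \equiv 2,3 \bmod 4$, let $k = \mathbb{Q}(\sqrt{\Delta})$ be the quadratic number field with discriminant $\Delta$, and let $\mathcal{C}: X^2 - \Delta Y^2 = 4$ be the associated Pell conic. For every positive squarefree divisor $a$ of $\Delta$ put $b = \Delta/a$ and call the curve $\mathcal{T}_a : a r^2 - b s^2 = 4$ a first descendant of $\mathcal{C}$. Let $\mathrm{Sel}_2(\mathcal{C}) \subseteq \mathbb{Q}^\times/\mathbb{Q}^{\times 2}$ be the set of square classes $a\mathbb{Q}^{\times 2}$ of those $a$ for which $\mathcal{T}_a$ has a rational point, and let $W(\mathcal{C})$ be the set of square classes of those $a$ for which $\mathcal{T}_a$ has an integral point; these are subgroups of $\mathbb{Q}^\times/\mathbb{Q}^{\times 2}$ with $W(\mathcal{C}) \subseteq \mathrm{Sel}_2(\mathcal{C})$. The $2$-part of the Tate–Shafarevich group of $\mathcal{C}$ is Ш$_2(\mathcal{C}) = \mathrm{Sel}_2(\mathcal{C})/W(\mathcal{C})$. Let $\mathrm{Cl}^+(k)$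 be the narrow class group of $k$ (fractional ideals modulo principal ideals with a totally positive generator), and let $\mathrm{Cl}^+(k)^2[2]$ be the subgroup of those narrow classes that are squares in $\mathrm{Cl}^+(k)$ and whose square is trivial. An ideal of the ring of integers of $k$ is called ambiguous if it is invariant under all automorphisms of $k$. Theorem. For every positive squarefree divisor $a$ of $\Delta$ there is exactly one ambiguous integral ideal $\mathfrak{a}$ of $k$ with norm $a$. There is a homomorphism $\mathrm{cl}: \mathrm{Sel}_2(\mathcal{C}) \to \mathrm{Cl}^+(k)^2[2]$ that sends the square class of $a$, for every $\mathcal{T}_a$ with a rational point, to the narrow class of the ambiguous ideal $\mathfrak{a}$ of norm $a$, and with it the sequence $$0 \longrightarrow W(\mathcal{C}) \longrightarrow \mathrm{Sel}_2(\mathcal{C}) \xrightarrow{\ \mathrm{cl}\ } \mathrm{Cl}^+(k)^2[2] \longrightarrow 0,$$ whose first nontrivial map is the inclusion, is exact. In particular $\mathrm{cl}$ induces an isomorphism Ш$_2(\mathcal{C}) \simeq \mathrm{Cl}^+(k)^2[2]$. -/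

import Mathlib

open NumberField
open scoped nonZeroDivisors

/-! ### Pell conics and their first descendants -/

/-- The discriminant `Δ` of the quadratic field `ℚ(√d)`, for squarefree `d ≠ 1`. -/
def pellDisc (d : ℤ) : ℤ := if d % 4 = 1 then d else 4 * d

/-- The integers `a` that index first descendants of `X² - ΔY² = 4`: the positive squarefree
divisors of `Δ`. -/
structure IsDescendantIndex (Δ a : ℤ) : Prop where
  pos : 0 < a
  squarefree : Squarefree a
  dvd : a ∣ Δ

/-- The `R`-points of the first descendant `T_a : a r² - b s² = 4` of `X² - ΔY² = 4`, where
`ab = Δ` (the division `Δ / a` is exact when `a` indexes a descendant). -/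
def descendantPoints (Δ a : ℤ) (R : Type*) [CommRing R] : Set (R × R) :=
  {p | (a : R) * p.1 ^ 2 - ((Δ / a : ℤ) : R) * p.2 ^ 2 = 4}

/-- The group `ℚˣ / ℚˣ²` of rational square classes. -/
abbrev RatSquareClass : Type := ℚˣ ⧸ (powMonoidHom 2 : ℚˣ →* ℚˣ).range

/-- The square class `a ℚˣ²` of a nonzero integer `a`. -/
def sqClass (a : ℤ) (ha : a ≠ 0) : RatSquareClass :=
  QuotientGroup.mk (Units.mk0 (a : ℚ) (Int.cast_ne_zero.mpr ha))

theorem sqClass_mul_eq {a b c k : ℤ} (ha : a ≠ 0) (hb : b ≠ 0) (hc : c ≠ 0) (hk : k ≠ 0)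
    (h : a * b = c * k ^ 2) : sqClass a ha * sqClass b hb = sqClass c hc := by
  unfold sqClass
  rw [← QuotientGroup.mk_mul, eq_comm, QuotientGroup.eq]
  refine ⟨Units.mk0 (k : ℚ) (Int.cast_ne_zero.mpr hk), ?_⟩
  rw [eq_inv_mul_iff_mul_eq]
  ext
  simp only [powMonoidHom_apply, Units.val_mul, Units.val_pow_eq_pow_val, Units.val_mk0]
  exact_mod_cast h.symm

theorem sqClass_inv (a : ℤ) (ha : a ≠ 0) : (sqClass a ha)⁻¹ = sqClass a ha := by
  rw [inv_eq_iff_mul_eq_one, sqClass_mul_eq ha ha one_ne_zero ha (by ring)]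
  unfold sqClass
  rw [QuotientGroup.eq_one_iff]
  exact ⟨1, by ext; simp⟩

theorem sqClass_one : sqClass 1 one_ne_zero = 1 := by
  unfold sqClass
  rw [QuotientGroup.eq_one_iff]
  exact ⟨1, by ext; simp⟩

theorem isDescendantIndex_one (Δ : ℤ) : IsDescendantIndex Δ 1 :=
  ⟨one_pos, squarefree_one, one_dvd _⟩

/-- The common divisor structure of two descendant indices `a = ku` and `a' = kv`. -/
theorem IsDescendantIndex.exists_mul {Δ a a' : ℤ} (h : IsDescendantIndex Δ a)
    (h' : IsDescendantIndex Δ a') :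
    ∃ k u v l : ℤ, a = k * u ∧ a' = k * v ∧ Δ = k * u * v * l ∧ k ≠ 0 ∧
      IsDescendantIndex Δ (u * v) ∧ ¬ (2 ∣ u ∧ 2 ∣ v) ∧ ¬ (4 ∣ k) ∧
      Δ / a = v * l ∧ Δ / a' = u * l ∧ Δ / (u * v) = k * l := by
  obtain ⟨g, u, v, hg, hco, ha, ha'⟩ := Int.exists_gcd_one' (m := a) (n := a')
    (Int.gcd_pos_of_ne_zero_left _ h.pos.ne')
  have hk : (0 : ℤ) < g := by exact_mod_cast hg
  have hu : 0 < u := by have := h.pos; rw [ha] at this; exact pos_of_mul_pos_left this hk.le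
  have hv : 0 < v := by have := h'.pos; rw [ha'] at this; exact pos_of_mul_pos_left this hk.le
  have hcop : IsCoprime u v := Int.isCoprime_iff_gcd_eq_one.mpr hco
  obtain ⟨m, hm⟩ := h.dvd
  obtain ⟨m', hm'⟩ := h'.dvd
  have hum : u * m = v * m' := by
    have : (g : ℤ) * (u * m) = g * (v * m') := by
      calc (g : ℤ) * (u * m) = a * m := by rw [ha]; ring
        _ = a' * m' := by rw [← hm, ← hm']
        _ = g * (v * m') := by rw [ha']; ring
    exact mul_left_cancel₀ hk.ne' this
  obtain ⟨l, hl⟩ : v ∣ m := hcop.symm.dvd_of_dvd_mul_left ⟨m', hum⟩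
  have hΔ : Δ = g * u * v * l := by rw [hm, hl, ha]; ring
  have hsu : Squarefree u := h.squarefree.squarefree_of_dvd ⟨g, by rw [ha]⟩
  have hsv : Squarefree v := h'.squarefree.squarefree_of_dvd ⟨g, by rw [ha']⟩
  refine ⟨g, u, v, l, by rw [ha]; ring, by rw [ha']; ring, hΔ, hk.ne',
    ⟨mul_pos hu hv, (squarefree_mul_iff.mpr ⟨hcop.isRelPrime, hsu, hsv⟩),
      ⟨g * l, by rw [hΔ]; ring⟩⟩, ?_, ?_, ?_, ?_, ?_⟩
  · rintro ⟨h1, h2⟩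
    have := hcop.isUnit_of_dvd' h1 h2
    rw [Int.isUnit_iff] at this
    omega
  · intro h4
    have : (2 : ℤ) * 2 ∣ a := by
      rw [ha]; exact Dvd.dvd.mul_left (by simpa using h4) _
    have := h.squarefree 2 this
    rw [Int.isUnit_iff] at this
    omega
  · exact Int.ediv_eq_of_eq_mul_right h.pos.ne' (by rw [hΔ, ha]; ring)
  · exact Int.ediv_eq_of_eq_mul_right h'.pos.ne' (by rw [hΔ, ha']; ring)
  · exact Int.ediv_eq_of_eq_mul_right (mul_pos hu hv).ne' (by rw [hΔ]; ring)

/-- The composition law on points of descendants. -/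
theorem descendant_identity {R : Type*} [CommRing R] {k u v l r s r' s' : R}
    (h : k * u * r ^ 2 - v * l * s ^ 2 = 4) (h' : k * v * r' ^ 2 - u * l * s' ^ 2 = 4) :
    u * v * (k * r * r' + l * s * s') ^ 2 - k * l * (u * r * s' + v * r' * s) ^ 2 = 16 := by
  linear_combination (k * v * r' ^ 2 - u * l * s' ^ 2) * h + 4 * h'

theorem descendant_parity {k u v l r s r' s' : ℤ} (huv : ¬ (2 ∣ u ∧ 2 ∣ v)) (hk : ¬ (4 ∣ k))
    (h : k * u * r ^ 2 - v * l * s ^ 2 = 4) (h' : k * v * r' ^ 2 - u * l * s' ^ 2 = 4) :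
    Even (k * r * r' + l * s * s') ∧ Even (u * r * s' + v * r' * s) := by
  rw [← even_iff_two_dvd, ← even_iff_two_dvd] at huv
  by_cases hkl : Even k ∧ Even l
  · obtain ⟨hek, hel⟩ := hkl
    refine ⟨by simp [Int.even_add, hek, hel], ?_⟩
    obtain ⟨k', rfl⟩ := hek
    obtain ⟨l', rfl⟩ := hel
    have f1 : k' * u * r ^ 2 - v * l' * s ^ 2 = 2 := by linarith
    have f2 : k' * v * r' ^ 2 - u * l' * s' ^ 2 = 2 := by linarith
    have g1 : Even (k' * u * r ^ 2 - v * l' * s ^ 2) := by rw [f1]; decide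
    have g2 : Even (k' * v * r' ^ 2 - u * l' * s' ^ 2) := by rw [f2]; decide
    have hk' : ¬ Even k' := by rintro ⟨m, rfl⟩; exact hk ⟨m, by ring⟩
    clear f1 f2 h h' hk
    by_cases hu : Even u <;> by_cases hv : Even v <;> by_cases hl : Even l' <;>
      simp_all [Int.even_add, Int.even_sub, Int.even_mul, Int.even_pow] <;>
      simp only [← Int.not_even_iff_odd] at * <;> tauto
  · have e1 : Even (k * u * r ^ 2 - v * l * s ^ 2) := by rw [h]; decide
    have e2 : Even (k * v * r' ^ 2 - u * l * s' ^ 2) := by rw [h']; decide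
    clear h h' hk
    by_cases hu : Even u <;> by_cases hv : Even v <;> by_cases hl : Even l <;>
      by_cases hek : Even k <;>
      simp_all [Int.even_add, Int.even_sub, Int.even_mul, Int.even_pow] <;>
      simp only [← Int.not_even_iff_odd] at * <;> tauto

/-- The `2`-Selmer group of the Pell conic `X² - ΔY² = 4`: the square classes of the indices `a`
whose descendant `T_a` has a rational point. -/
def pellSelmer (Δ : ℤ) : Subgroup RatSquareClass where
  carrier := {x | ∃ (a : ℤ) (h : IsDescendantIndex Δ a),
    x = sqClass a h.pos.ne' ∧ (descendantPoints Δ a ℚ).Nonempty}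
  one_mem' := ⟨1, isDescendantIndex_one Δ, sqClass_one.symm, (2, 0), by
    norm_num [descendantPoints]⟩
  inv_mem' := by
    rintro x ⟨a, h, rfl, hp⟩
    exact ⟨a, h, sqClass_inv _ _, hp⟩
  mul_mem' := by
    rintro x y ⟨a, h, rfl, ⟨r, s⟩, hp⟩ ⟨a', h', rfl, ⟨r', s'⟩, hp'⟩
    obtain ⟨k, u, v, l, ha, ha', -, hk, huv, -, -, d1, d2, d3⟩ := h.exists_mul h'
    refine ⟨u * v, huv, sqClass_mul_eq (k := k) _ _ _ hk (by rw [ha, ha']; ring),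
      ((k * r * r' + l * s * s') / 2, (u * r * s' + v * r' * s) / 2), ?_⟩
    simp only [descendantPoints, Set.mem_ofPred_eq, d1, d2, d3] at hp hp' ⊢
    rw [ha] at hp
    rw [ha'] at hp'
    push_cast at hp hp' ⊢
    linear_combination (descendant_identity hp hp') / 4

/-- The group `W(C)` of the Pell conic `X² - ΔY² = 4`: the square classes of the indices `a`
whose descendant `T_a` has an integral point. -/
def pellW (Δ : ℤ) : Subgroup RatSquareClass where
  carrier := {x | ∃ (a : ℤ) (h : IsDescendantIndex Δ a),
    x = sqClass a h.pos.ne' ∧ (descendantPoints Δ a ℤ).Nonempty}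
  one_mem' := ⟨1, isDescendantIndex_one Δ, sqClass_one.symm, (2, 0), by
    norm_num [descendantPoints]⟩
  inv_mem' := by
    rintro x ⟨a, h, rfl, hp⟩
    exact ⟨a, h, sqClass_inv _ _, hp⟩
  mul_mem' := by
    rintro x y ⟨a, h, rfl, ⟨r, s⟩, hp⟩ ⟨a', h', rfl, ⟨r', s'⟩, hp'⟩
    obtain ⟨k, u, v, l, ha, ha', -, hk, huv, h2, h4, d1, d2, d3⟩ := h.exists_mul h'
    simp only [descendantPoints, Set.mem_ofPred_eq, d1, d2, Int.cast_id] at hp hp'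
    rw [ha] at hp
    rw [ha'] at hp'
    obtain ⟨⟨R, hR⟩, ⟨S, hS⟩⟩ := descendant_parity h2 h4 hp hp'
    refine ⟨u * v, huv, sqClass_mul_eq (k := k) _ _ _ hk (by rw [ha, ha']; ring), (R, S), ?_⟩
    simp only [descendantPoints, Set.mem_ofPred_eq, d3, Int.cast_id]
    have := descendant_identity hp hp'
    rw [hR, hS] at this
    linarith

theorem pellW_le_pellSelmer (Δ : ℤ) : pellW Δ ≤ pellSelmer Δ := by
  rintro x ⟨a, h, rfl, ⟨r, s⟩, hp⟩
  refine ⟨a, h, rfl, ((r : ℚ), (s : ℚ)), ?_⟩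
  simp only [descendantPoints, Set.mem_ofPred_eq, Int.cast_id] at hp ⊢
  exact_mod_cast hp

/-- The `2`-part of the Tate–Shafarevich group of the Pell conic `X² - ΔY² = 4`. -/
abbrev PellSha (Δ : ℤ) : Type := pellSelmer Δ ⧸ (pellW Δ).subgroupOf (pellSelmer Δ)

/-! ### Narrow class groups and ambiguous ideals -/

section NarrowClassGroup

variable (k : Type*) [Field k] [NumberField k]

/-- The elements of `kˣ` that are positive under every real embedding of `k`. -/
def totallyPositiveUnits : Subgroup kˣ where
  carrier := {x | ∀ φ : k →+* ℝ, 0 < φ x}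
  one_mem' := fun φ => by simp
  mul_mem' := fun {x y} hx hy φ => by
    rw [Units.val_mul, map_mul]
    exact mul_pos (hx φ) (hy φ)
  inv_mem' := fun {x} hx φ => by
    rw [Units.val_inv_eq_inv_val, map_inv₀]
    exact inv_pos.mpr (hx φ)

/-- The narrow class group `Cl⁺(k)`: fractional ideals modulo principal fractional ideals with a
totally positive generator. -/
def NarrowClassGroup : Type _ :=
  (FractionalIdeal (𝓞 k)⁰ k)ˣ ⧸ (totallyPositiveUnits k).map (toPrincipalIdeal (𝓞 k) k)

noncomputable instance : CommGroup (NarrowClassGroup k) :=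
  inferInstanceAs (CommGroup
    ((FractionalIdeal (𝓞 k)⁰ k)ˣ ⧸ (totallyPositiveUnits k).map (toPrincipalIdeal (𝓞 k) k)))

/-- The narrow class of an invertible fractional ideal. -/
noncomputable def narrowClassMk : (FractionalIdeal (𝓞 k)⁰ k)ˣ →* NarrowClassGroup k :=
  QuotientGroup.mk' ((totallyPositiveUnits k).map (toPrincipalIdeal (𝓞 k) k))

/-- The narrow class of a nonzero integral ideal. -/
noncomputable def narrowClass (I : (Ideal (𝓞 k))⁰) : NarrowClassGroup k :=
  narrowClassMk k (FractionalIdeal.mk0 k I)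

/-- The group `Cl⁺(k)²[2]` of narrow classes that are squares and whose square is trivial. -/
noncomputable def narrowSquaresTwoTorsion : Subgroup (NarrowClassGroup k) :=
  (powMonoidHom 2 : NarrowClassGroup k →* NarrowClassGroup k).range ⊓
    (powMonoidHom 2 : NarrowClassGroup k →* NarrowClassGroup k).ker

variable {k}

/-- An ideal of `𝓞 k` is ambiguous if it is invariant under all automorphisms of `k`. -/
def IsAmbiguous (I : Ideal (𝓞 k)) : Prop :=
  ∀ σ : k ≃+* k, I.map (RingOfIntegers.mapRingEquiv σ) = I

end NarrowClassGroup

/-! ### The integral basis of a quadratic field -/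

/-! The proof runs through ideals `I` with `I² = (a)`. Since `I · Ī = (N I)` (`mul_conjIdeal`), an
ideal is ambiguous of norm `a` exactly when its square is `(a)`. Square roots of ideals are unique,
and for `a ∣ Δ` squarefree one exists (`exists_sq_eq`). The map `cl` sends the class of `a` to the
narrow class of this `I`. Points on `T_a` become elements of `k`: `x = (ar + s√Δ)/2` has norm `a(ar²
- bs²)/4 = a`. An integral point gives an integer of norm `a`, and this integer generates `I`. A
rational point gives an integer whose norm is `a` times a square, which happens exactly when the
narrow class of `I` is a square. This identifies the kernel of `cl` and the condition for its image.
Signs cause no trouble: an element of positive norm is totally positive up to sign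
(`isTotPos_or_neg`). For surjectivity, Hilbert 90 moves an ideal whose class has order dividing 2 to
a conjugation-invariant ideal in the same narrow class. Removing its rational factor leaves `I² =
(a)` with `a` squarefree, and such an `a` divides `Δ` (`dvd_disc_of_sq_eq`). -/

theorem Squarefree.exists_int_of_mul_sq {d m : ℤ} (hd : Squarefree d) {w : ℚ}
    (h : (d : ℚ) * w ^ 2 = m) : ∃ W : ℤ, w = W := by
  have hden : (w.den : ℚ) ≠ 0 := by exact_mod_cast w.den_nz
  have h1 : d * w.num ^ 2 = m * (w.den : ℤ) ^ 2 := by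
    have : (d : ℚ) * w.num ^ 2 = m * (w.den : ℚ) ^ 2 := by
      rw [← h]
      nth_rewrite 2 [← Rat.num_div_den w]
      field_simp
    exact_mod_cast this
  -- In lowest terms the squared denominator must divide `d`, so squarefreeness makes it 1.
  have hco : IsCoprime ((w.den : ℤ) ^ 2) (w.num ^ 2) := by
    apply IsCoprime.pow
    rw [Int.isCoprime_iff_gcd_eq_one]
    have := w.reduced
    rw [Nat.coprime_comm] at this
    simpa [Int.gcd, Nat.Coprime] using this
  have h2 : (w.den : ℤ) * w.den ∣ d := by
    rw [← sq]
    exact hco.dvd_of_dvd_mul_right ⟨m, by rw [h1]; ring⟩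
  have h3 := hd _ h2
  have h4 : w.den = 1 := by
    rw [Int.isUnit_iff] at h3
    omega
  exact ⟨w.num, (Rat.den_eq_one_iff w |>.mp h4).symm⟩

theorem Squarefree.not_int_sq {d e : ℤ} (hd : Squarefree d) (hd1 : d ≠ 1) : e ^ 2 ≠ d := by
  rintro rfl
  have := hd e (by rw [sq])
  rw [Int.isUnit_iff] at this
  rcases this with rfl | rfl <;> simp at hd1

theorem pellDisc_eq (d : ℤ) :
    (d % 4 = 1 ∧ pellDisc d = d) ∨ (d % 4 ≠ 1 ∧ pellDisc d = 2 ^ 2 * d) := by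
  unfold pellDisc
  split_ifs with h
  · exact Or.inl ⟨h, rfl⟩
  · exact Or.inr ⟨h, by ring⟩

theorem Squarefree.not_four_dvd {d : ℤ} (hd : Squarefree d) : ¬ (4 ∣ d) := by
  intro h
  have := hd 2 (by simpa using h)
  rw [Int.isUnit_iff] at this
  omega

theorem pellDisc_not_rat_sq {d : ℤ} (hd : Squarefree d) (hd1 : d ≠ 1) (w : ℚ) :
    w ^ 2 ≠ (pellDisc d : ℤ) := by
  have key : ∀ v : ℚ, v ^ 2 ≠ (d : ℤ) := by
    intro v hv
    obtain ⟨V, rfl⟩ : ∃ V : ℤ, v = V := by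
      refine (squarefree_one (R := ℤ)).exists_int_of_mul_sq (m := d) ?_
      rw [← hv]; push_cast; ring
    exact hd.not_int_sq hd1 (by exact_mod_cast hv)
  intro hw
  rcases pellDisc_eq d with ⟨-, h⟩ | ⟨-, h⟩
  · exact key w (by rw [hw, h])
  · refine key (w / 2) ?_
    rw [div_pow, hw, h]
    push_cast
    ring

theorem exists_pellDisc_eq (d : ℤ) : ∃ t n : ℤ, t ^ 2 - 4 * n = pellDisc d := by
  rcases pellDisc_eq d with ⟨h, h'⟩ | ⟨-, h'⟩
  · exact ⟨1, (1 - d) / 4, by rw [h']; omega⟩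
  · exact ⟨0, -d, by rw [h']; ring⟩

theorem Int.sq_emod_four (u : ℤ) : (u % 2 = 0 ∧ u ^ 2 % 4 = 0) ∨ (u % 2 = 1 ∧ u ^ 2 % 4 = 1) := by
  rcases Int.even_or_odd' u with ⟨m, rfl | rfl⟩
  · left; ring_nf; omega
  · right; ring_nf; omega

/-- The coordinates of an algebraic integer `(u + w√Δ)/2` of the quadratic field of
discriminant `Δ`. -/
theorem exists_int_of_pellDisc_mul_sq {d t n u N : ℤ} (hd : Squarefree d)
    (ht : t ^ 2 - 4 * n = pellDisc d) {w : ℚ}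
    (h : (u : ℚ) ^ 2 - 4 * N = (pellDisc d : ℤ) * w ^ 2) :
    ∃ W i : ℤ, w = W ∧ u = 2 * i + t * W := by
  obtain ⟨W, rfl⟩ : ∃ W : ℤ, w = W := by
    rcases pellDisc_eq d with ⟨-, h'⟩ | ⟨h1, h'⟩
    · rw [h'] at h
      exact hd.exists_int_of_mul_sq (m := u ^ 2 - 4 * N) (by push_cast; linarith)
    · rw [h'] at h
      have h2 : (d : ℚ) * (2 * w) ^ 2 = ((u ^ 2 - 4 * N : ℤ) : ℚ) := by
        push_cast at h ⊢; linarith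
      obtain ⟨V, hV⟩ := hd.exists_int_of_mul_sq h2
      rw [hV] at h2
      have h3 : d * V ^ 2 = u ^ 2 - 4 * N := by exact_mod_cast h2
      -- If `V = 2w` were odd, then `d ≡ u²` mod 4 would be 0 or 1, and both are excluded when `Δ =
      -- 4d`.
      have h4 := hd.not_four_dvd
      rcases Int.sq_emod_four V with ⟨hv, -⟩ | ⟨-, hv⟩
      · refine ⟨V / 2, ?_⟩
        have : V = 2 * (V / 2) := by omega
        have h5 : (V : ℚ) = 2 * (V / 2 : ℤ) := by exact_mod_cast this
        linarith
      · exfalso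
        have e : d * V ^ 2 = d + 4 * (d * (V ^ 2 / 4)) := by
          have : V ^ 2 = 1 + 4 * (V ^ 2 / 4) := by omega
          nth_rewrite 1 [this]; ring
        generalize d * (V ^ 2 / 4) = q at e
        rcases Int.sq_emod_four u with ⟨-, hu⟩ | ⟨-, hu⟩ <;> omega
  have h1 : u ^ 2 - 4 * N = (t ^ 2 - 4 * n) * W ^ 2 := by rw [ht]; exact_mod_cast h
  -- Squares congruent mod 4 have roots of equal parity, so `u - tW` is even.
  have h2 : u ^ 2 = (t * W) ^ 2 + 4 * (N - n * W ^ 2) := by linarith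
  generalize N - n * W ^ 2 = q at h2
  refine ⟨W, (u - t * W) / 2, rfl, ?_⟩
  rcases Int.sq_emod_four u with ⟨_, hu⟩ | ⟨_, hu⟩ <;>
    rcases Int.sq_emod_four (t * W) with ⟨_, hv⟩ | ⟨_, hv⟩ <;> omega

/-- A `ℤ`-basis `1, ω` of the ring of integers of a quadratic field of discriminant `Δ`, with the
nontrivial automorphism of the field. -/
structure QuadraticBasis (k : Type*) [Field k] [NumberField k] (Δ : ℤ) where
  conj : k ≃+* k
  ω : 𝓞 k
  t : ℤ
  n : ℤ
  disc : t ^ 2 - 4 * n = Δ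
  ω_sq : ω ^ 2 = t * ω - n
  conj_ω : RingOfIntegers.mapRingEquiv conj ω = t - ω
  exists_rep : ∀ x : 𝓞 k, ∃ i j : ℤ, x = i + j * ω
  coord_zero : ∀ i j : ℤ, (i : 𝓞 k) + j * ω = 0 → i = 0 ∧ j = 0

/-! ### Rational coordinates, the conjugation, and the ring of integers. -/

section

variable {k : Type*} [Field k] [NumberField k]

theorem exists_rat_coord (hk : Module.finrank ℚ k = 2) {δ : k} (hδ : ∀ q : ℚ, δ ≠ q) (x : k) :
    ∃ α β : ℚ, x = α + β * δ := by
  have hli : LinearIndependent ℚ ![(1 : k), δ] := by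
    rw [LinearIndependent.pair_iff]
    intro s t h
    simp only [Algebra.smul_def, eq_ratCast, mul_one] at h
    have ht : t = 0 := by
      by_contra ht
      have ht' : (t : k) ≠ 0 := by exact_mod_cast ht
      refine hδ (-s / t) ?_
      push_cast
      field_simp
      linear_combination h
    subst ht
    exact ⟨by simpa using h, rfl⟩
  have hsp := hli.span_eq_top_of_card_eq_finrank (by simp [hk])
  have hx : x ∈ Submodule.span ℚ (Set.range ![(1 : k), δ]) := by rw [hsp]; trivial
  rw [Matrix.range_cons, Matrix.range_cons, Matrix.range_empty, Set.union_empty,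
    Set.singleton_union, Submodule.mem_span_pair] at hx
  obtain ⟨a, b, h⟩ := hx
  exact ⟨a, b, by rw [← h]; simp [Algebra.smul_def]⟩

theorem exists_conj (hk : Module.finrank ℚ k = 2) {δ : k} {Δ : ℤ} (hδ : ∀ q : ℚ, δ ≠ q)
    (hδ2 : δ ^ 2 = (Δ : k)) : ∃ σ : k ≃+* k, σ δ = -δ := by
  have : Algebra.IsQuadraticExtension ℚ k := ⟨hk⟩
  have hcard := IsGalois.card_aut_eq_finrank ℚ k
  rw [hk] at hcard
  have : Nontrivial (k ≃ₐ[ℚ] k) := by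
    have : Finite (k ≃ₐ[ℚ] k) := Nat.finite_of_card_ne_zero (by rw [hcard]; norm_num)
    rw [← Finite.one_lt_card_iff_nontrivial, hcard]
    norm_num
  obtain ⟨σ, hσ⟩ := exists_ne (1 : k ≃ₐ[ℚ] k)
  refine ⟨σ.toRingEquiv, ?_⟩
  have h2 : σ δ ^ 2 = δ ^ 2 := by rw [← map_pow, hδ2, map_intCast]
  rcases sq_eq_sq_iff_eq_or_eq_neg.mp h2 with h | h
  · refine absurd (AlgEquiv.ext fun x => ?_) hσ
    obtain ⟨α, β, rfl⟩ := exists_rat_coord hk hδ x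
    simp [h]
  · exact h

theorem exists_int_of_isIntegral {x : k} {q : ℚ} (hx : IsIntegral ℤ x) (h : x = q) :
    ∃ m : ℤ, q = m := by
  subst h
  have h1 : IsIntegral ℤ q := by
    rw [← isIntegral_algebraMap_iff (B := k) (algebraMap ℚ k).injective]
    simpa using hx
  obtain ⟨m, hm⟩ := IsIntegrallyClosed.isIntegral_iff.mp h1
  exact ⟨m, by rw [← hm]; simp⟩

/-- Take `ω = (t + δ)/2`. For an integer `α + βδ` of `k`, the trace `2α` and the norm `α² - Δβ²` are
integral and rational, hence in `ℤ`. `exists_int_of_pellDisc_mul_sq` with `w = 2β` then yields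
integral coordinates. -/
theorem exists_quadraticBasis {d : ℤ} (hd : Squarefree d) (hd1 : d ≠ 1)
    (hk : Module.finrank ℚ k = 2) {δ : k} (hδ2 : δ ^ 2 = ((pellDisc d : ℤ) : k)) :
    Nonempty (QuadraticBasis k (pellDisc d)) := by
  have hδ : ∀ q : ℚ, δ ≠ q := by
    rintro q rfl
    exact pellDisc_not_rat_sq hd hd1 q (by exact_mod_cast hδ2)
  obtain ⟨σ, hσ⟩ := exists_conj hk hδ hδ2
  obtain ⟨t, n, ht⟩ := exists_pellDisc_eq d
  have htk : (t : k) ^ 2 - 4 * n = ((pellDisc d : ℤ) : k) := by exact_mod_cast congrArg Int.cast ht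
  have hsq : ((t + δ) / 2) ^ 2 = t * ((t + δ) / 2) - (n : k) := by
    linear_combination (hδ2 - htk) / 4
  have hint : IsIntegral ℤ ((t + δ) / 2) := by
    refine ⟨Polynomial.X ^ 2 - (Polynomial.C t * Polynomial.X - Polynomial.C n), by monicity!, ?_⟩
    simp only [Polynomial.eval₂_sub, Polynomial.eval₂_mul, Polynomial.eval₂_pow,
      Polynomial.eval₂_X, Polynomial.eval₂_C, algebraMap_int_eq]
    simp only [eq_intCast, hsq, sub_self]
  obtain ⟨ω, hω⟩ : ∃ ω : 𝓞 k, algebraMap (𝓞 k) k ω = (t + δ) / 2 := ⟨⟨_, hint⟩, rfl⟩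
  refine ⟨⟨σ, ω, t, n, ht, ?_, ?_, ?_, ?_⟩⟩
  · apply RingOfIntegers.coe_injective
    simpa [hω] using hsq
  · apply RingOfIntegers.coe_injective
    change σ (algebraMap (𝓞 k) k ω) = _
    rw [map_sub, hω, map_div₀, map_add, hσ, map_intCast, map_intCast, map_ofNat]
    ring
  · intro x
    obtain ⟨α, β, hx⟩ := exists_rat_coord hk hδ (algebraMap (𝓞 k) k x)
    have hσx : σ (algebraMap (𝓞 k) k x) = α - β * δ := by rw [hx]; simp [hσ]; ring
    have hxi := RingOfIntegers.isIntegral_coe x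
    have hyi := RingOfIntegers.isIntegral_coe (RingOfIntegers.mapRingEquiv σ x)
    change IsIntegral ℤ (σ (algebraMap (𝓞 k) k x)) at hyi
    obtain ⟨u, hu⟩ := exists_int_of_isIntegral (q := 2 * α) (hxi.add hyi)
      (by rw [hσx, hx]; push_cast; ring)
    obtain ⟨N, hN⟩ := exists_int_of_isIntegral (q := α ^ 2 - (pellDisc d : ℤ) * β ^ 2)
      (hxi.mul hyi) (by rw [hσx, hx]; push_cast; rw [← hδ2]; ring)
    obtain ⟨j, i, hj, hi⟩ := exists_int_of_pellDisc_mul_sq (u := u) (N := N) (w := 2 * β) hd ht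
      (by rw [← hu, ← hN]; ring)
    refine ⟨i, j, ?_⟩
    apply RingOfIntegers.coe_injective
    have h1 : (2 * α : k) = 2 * i + t * j := by
      exact_mod_cast congrArg (Rat.cast : ℚ → k) (hu.trans (by rw [hi]))
    have h2 : (2 * β : k) = j := by exact_mod_cast congrArg (Rat.cast : ℚ → k) hj
    simp only [map_add, map_mul, map_intCast, hω]
    rw [hx]
    linear_combination h1 / 2 + h2 * δ / 2
  · intro i j h
    have h' := congrArg (algebraMap (𝓞 k) k) h
    simp only [map_add, map_mul, map_intCast, hω, map_zero] at h'
    have hj : j = 0 := by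
      by_contra hj
      have hj' : (j : k) ≠ 0 := by exact_mod_cast hj
      refine hδ (-(2 * i + j * t) / j) ?_
      push_cast
      field_simp
      linear_combination 2 * h'
    subst hj
    exact ⟨by exact_mod_cast (by simpa using h' : (i : k) = 0), rfl⟩

end

/-! ### Conjugation and the norm of ideals -/

theorem Ideal.absNorm_map_ringEquiv {R S : Type*} [CommRing R] [CommRing S] [IsDedekindDomain R]
    [IsDedekindDomain S] [Module.Free ℤ R] [Module.Free ℤ S] [Module.Finite ℤ R]
    [Module.Finite ℤ S] (e : R ≃+* S) (I : Ideal R) :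
    Ideal.absNorm (I.map e) = Ideal.absNorm I := by
  rw [Ideal.absNorm_apply, Ideal.absNorm_apply, Submodule.cardQuot_apply,
    Submodule.cardQuot_apply]
  exact (Nat.card_congr (Ideal.quotientEquiv I _ e rfl).toEquiv).symm

theorem Ideal.eq_of_sq_eq_sq {R : Type*} [CommRing R] [IsDedekindDomain R] {I J : Ideal R}
    (h : I ^ 2 = J ^ 2) : I = J :=
  dvd_antisymm ((UniqueFactorizationMonoid.pow_dvd_pow_iff_dvd two_ne_zero).mp h.dvd)
    ((UniqueFactorizationMonoid.pow_dvd_pow_iff_dvd two_ne_zero).mp h.symm.dvd)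

namespace QuadraticBasis

variable {k : Type*} [Field k] [NumberField k] {Δ : ℤ} (B : QuadraticBasis k Δ)

/-- The conjugation of the ring of integers. -/
noncomputable def conjInt : 𝓞 k ≃+* 𝓞 k := RingOfIntegers.mapRingEquiv B.conj

theorem conjInt_ω : B.conjInt B.ω = B.t - B.ω := B.conj_ω

theorem exists_trace_norm (x : 𝓞 k) : ∃ i j : ℤ, x = i + j * B.ω ∧
    x + B.conjInt x = ((2 * i + B.t * j : ℤ) : 𝓞 k) ∧
    x * B.conjInt x = ((i ^ 2 + B.t * i * j + B.n * j ^ 2 : ℤ) : 𝓞 k) := by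
  obtain ⟨i, j, hx⟩ := B.exists_rep x
  have hc : B.conjInt x = i + j * (B.t - B.ω) := by
    rw [hx]; simp [B.conjInt_ω]
  refine ⟨i, j, hx, ?_, ?_⟩
  · rw [hc, hx]; push_cast; ring
  · rw [hc, hx]; push_cast; linear_combination (-(j : 𝓞 k) ^ 2) * B.ω_sq

theorem conjInt_conjInt (x : 𝓞 k) : B.conjInt (B.conjInt x) = x := by
  obtain ⟨i, j, rfl⟩ := B.exists_rep x
  simp [B.conjInt_ω]

theorem exists_int_mul_conjInt (x : 𝓞 k) : ∃ m : ℤ, x * B.conjInt x = m := by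
  obtain ⟨i, j, -, -, h⟩ := B.exists_trace_norm x
  exact ⟨_, h⟩

/-- The conjugate of an ideal. -/
noncomputable def conjIdeal (I : Ideal (𝓞 k)) : Ideal (𝓞 k) := I.map B.conjInt

theorem conjIdeal_mul (I J : Ideal (𝓞 k)) :
    B.conjIdeal (I * J) = B.conjIdeal I * B.conjIdeal J := Ideal.map_mul _ _ _

theorem conjIdeal_sup (I J : Ideal (𝓞 k)) :
    B.conjIdeal (I ⊔ J) = B.conjIdeal I ⊔ B.conjIdeal J := Ideal.map_sup _ _ _

theorem conjIdeal_span (x : 𝓞 k) :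
    B.conjIdeal (Ideal.span {x}) = Ideal.span {B.conjInt x} := by
  rw [conjIdeal, Ideal.map_span, Set.image_singleton]

theorem conjIdeal_span_int (m : ℤ) :
    B.conjIdeal (Ideal.span {(m : 𝓞 k)}) = Ideal.span {(m : 𝓞 k)} := by
  rw [conjIdeal_span, map_intCast]

theorem mem_conjIdeal {I : Ideal (𝓞 k)} {x : 𝓞 k} :
    x ∈ B.conjIdeal I ↔ ∃ y ∈ I, B.conjInt y = x :=
  Ideal.mem_map_of_equiv B.conjInt x

theorem conjIdeal_conjIdeal (I : Ideal (𝓞 k)) : B.conjIdeal (B.conjIdeal I) = I := by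
  ext x
  rw [mem_conjIdeal]
  constructor
  · rintro ⟨y, hy, rfl⟩
    obtain ⟨z, hz, rfl⟩ := B.mem_conjIdeal.mp hy
    rwa [conjInt_conjInt]
  · intro hx
    exact ⟨B.conjInt x, B.mem_conjIdeal.mpr ⟨x, hx, rfl⟩, B.conjInt_conjInt x⟩

theorem conjInt_mem_conjIdeal {I : Ideal (𝓞 k)} {x : 𝓞 k} (hx : x ∈ I) :
    B.conjInt x ∈ B.conjIdeal I := B.mem_conjIdeal.mpr ⟨x, hx, rfl⟩

end QuadraticBasis

/-- For `g ≠ 0`, the quotient `y/g` is a root of the monic polynomial `X² - sX + p`. -/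
theorem dvd_of_sq_eq {R : Type*} [CommRing R] [IsDomain R] [IsIntegrallyClosed R] {g y s p : R}
    (h : y ^ 2 = g * s * y - g ^ 2 * p) : g ∣ y := by
  rcases eq_or_ne g 0 with rfl | hg
  · have : y ^ 2 = 0 := by rw [h]; ring
    rw [pow_eq_zero_iff two_ne_zero] at this
    rw [this]
  · obtain ⟨K, _, _, _⟩ : ∃ (K : Type _) (_ : Field K) (_ : Algebra R K), IsFractionRing R K :=
      ⟨FractionRing R, inferInstance, inferInstance, inferInstance⟩
    have hg' : algebraMap R K g ≠ 0 := by
      simpa using hg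
    have hz : IsIntegral R (algebraMap R K y / algebraMap R K g) := by
      refine ⟨Polynomial.X ^ 2 - (Polynomial.C s * Polynomial.X - Polynomial.C p), by monicity!, ?_⟩
      have h' := congrArg (algebraMap R K) h
      simp only [map_pow, map_sub, map_mul] at h'
      simp only [Polynomial.eval₂_sub, Polynomial.eval₂_mul, Polynomial.eval₂_pow,
        Polynomial.eval₂_X, Polynomial.eval₂_C]
      field_simp
      linear_combination h'
    obtain ⟨z, hz⟩ := IsIntegrallyClosed.isIntegral_iff.mp hz
    refine ⟨z, IsFractionRing.injective R K ?_⟩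
    rw [map_mul, hz]
    field_simp

namespace QuadraticBasis

variable {k : Type*} [Field k] [NumberField k] {Δ : ℤ}

theorem finrank_int (B : QuadraticBasis k Δ) : Module.finrank ℤ (𝓞 k) = 2 := by
  have hli : LinearIndependent ℤ ![(1 : 𝓞 k), B.ω] := by
    rw [LinearIndependent.pair_iff]
    intro i j h
    exact B.coord_zero i j (by simpa using h)
  have hsp : ⊤ ≤ Submodule.span ℤ (Set.range ![(1 : 𝓞 k), B.ω]) := by
    intro x _
    rw [Matrix.range_cons, Matrix.range_cons, Matrix.range_empty, Set.union_empty,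
      Set.singleton_union, Submodule.mem_span_pair]
    obtain ⟨i, j, h⟩ := B.exists_rep x
    exact ⟨i, j, by rw [h]; simp⟩
  rw [Module.finrank_eq_card_basis (Module.Basis.mk hli hsp), Fintype.card_fin]

theorem absNorm_span_int (B : QuadraticBasis k Δ) (m : ℤ) : Ideal.absNorm (Ideal.span {(m : 𝓞 k)}) = m.natAbs ^ 2 := by
  have h := Algebra.norm_algebraMap_of_basis (Module.finBasis ℤ (𝓞 k)) m
  rw [Fintype.card_fin, B.finrank_int] at h
  rw [Ideal.absNorm_span_singleton, ← Int.natAbs_pow, ← h]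
  simp

/-- Let `g` generate the ideal of `ℤ` spanned by the norms of elements of `I`. For `a, b ∈ I`, the
element `a b̄` has trace `N(a+b) - N(a) - N(b)`, divisible by `g`, and norm `N(a)N(b)`, divisible by
`g²`. Hence `g ∣ a b̄`, and `I · Ī = (g)`. Comparing absolute norms gives `|g| = N I`. -/
theorem mul_conjIdeal (B : QuadraticBasis k Δ) (I : Ideal (𝓞 k)) :
    I * B.conjIdeal I = Ideal.span {((Ideal.absNorm I : ℤ) : 𝓞 k)} := by
  set G : Ideal ℤ := Ideal.span {m | ∃ x ∈ I, x * B.conjInt x = (m : 𝓞 k)} with hG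
  obtain ⟨g, hg⟩ := (IsPrincipalIdealRing.principal G).principal
  rw [Ideal.submodule_span_eq] at hg
  have hmem : ∀ {x : 𝓞 k} {m : ℤ}, x ∈ I → x * B.conjInt x = m → ∃ q, m = g * q := by
    intro x m hx hm
    have : m ∈ G := Ideal.subset_span ⟨x, hx, hm⟩
    rw [hg, Ideal.mem_span_singleton] at this
    exact this
  have key : I * B.conjIdeal I = Ideal.span {(g : 𝓞 k)} := by
    apply le_antisymm
    · rw [Ideal.mul_le]
      intro a ha b' hb'
      obtain ⟨b, hb, rfl⟩ := B.mem_conjIdeal.mp hb'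
      obtain ⟨ma, hma⟩ := B.exists_int_mul_conjInt a
      obtain ⟨mb, hmb⟩ := B.exists_int_mul_conjInt b
      obtain ⟨mc, hmc⟩ := B.exists_int_mul_conjInt (a + b)
      obtain ⟨p, rfl⟩ := hmem ha hma
      obtain ⟨q, rfl⟩ := hmem hb hmb
      obtain ⟨s, rfl⟩ := hmem (I.add_mem ha hb) hmc
      rw [Ideal.mem_span_singleton]
      apply dvd_of_sq_eq (s := ((s - p - q : ℤ) : 𝓞 k)) (p := ((p * q : ℤ) : 𝓞 k))
      rw [map_add] at hmc
      push_cast at hma hmb hmc ⊢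
      linear_combination (-a * B.conjInt b) * hma - a * B.conjInt b * hmb
        + (a * B.conjInt b) * hmc - b * B.conjInt b * hma - g * p * hmb
    · rw [Ideal.span_singleton_le_iff_mem]
      have : G ≤ Ideal.comap (Int.castRingHom (𝓞 k)) (I * B.conjIdeal I) := by
        rw [hG, Ideal.span_le]
        rintro m ⟨x, hx, hm⟩
        rw [SetLike.mem_coe, Ideal.mem_comap, eq_intCast, ← hm]
        exact Ideal.mul_mem_mul hx (B.conjInt_mem_conjIdeal hx)
      exact this (by rw [hg]; exact Ideal.mem_span_singleton_self g)
  have hn := congrArg Ideal.absNorm key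
  rw [map_mul, conjIdeal, Ideal.absNorm_map_ringEquiv, B.absNorm_span_int, ← sq] at hn
  have hn' : (Ideal.absNorm I) = g.natAbs := Nat.pow_left_injective two_ne_zero hn
  rw [key, hn']
  rcases Int.natAbs_eq g with h | h
  · rw [← h]
  · rw [Ideal.span_singleton_eq_span_singleton]
    refine (Associated.refl _).neg_right.trans ?_
    nth_rewrite 1 [h]
    push_cast
    rw [neg_neg]

theorem eq_of_span_int_eq (B : QuadraticBasis k Δ) {m n : ℤ} (hm : 0 < m) (hn : 0 < n)
    (h : Ideal.span {(m : 𝓞 k)} = Ideal.span {(n : 𝓞 k)}) : m = n := by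
  have := congrArg Ideal.absNorm h
  rw [B.absNorm_span_int, B.absNorm_span_int] at this
  have := Nat.pow_left_injective two_ne_zero this
  omega

/-- Automorphisms fix `(a)`, and square roots of ideals are unique. With `absNorm_of_sq_eq` and
`sq_eq_of_isAmbiguous`, the equation `I² = (a)` for `a > 0` can replace "ambiguous of norm `a`". -/
theorem isAmbiguous_of_sq_eq {I : Ideal (𝓞 k)} {a : ℤ} (h : I ^ 2 = Ideal.span {(a : 𝓞 k)}) :
    IsAmbiguous I := by
  intro σ
  apply Ideal.eq_of_sq_eq_sq
  rw [← Ideal.map_pow, h, Ideal.map_span, Set.image_singleton, map_intCast]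

theorem conjIdeal_of_isAmbiguous (B : QuadraticBasis k Δ) {I : Ideal (𝓞 k)} (h : IsAmbiguous I) : B.conjIdeal I = I :=
  h B.conj

theorem absNorm_of_sq_eq (B : QuadraticBasis k Δ) {I : Ideal (𝓞 k)} {a : ℤ} (ha : 0 < a)
    (h : I ^ 2 = Ideal.span {(a : 𝓞 k)}) : ((Ideal.absNorm I : ℕ) : ℤ) = a := by
  have := congrArg Ideal.absNorm h
  rw [map_pow, B.absNorm_span_int] at this
  have := Nat.pow_left_injective two_ne_zero this
  omega

theorem sq_eq_of_isAmbiguous (B : QuadraticBasis k Δ) {I : Ideal (𝓞 k)} {a : ℤ} (h : IsAmbiguous I)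
    (hn : ((Ideal.absNorm I : ℕ) : ℤ) = a) : I ^ 2 = Ideal.span {(a : 𝓞 k)} := by
  rw [← hn, ← B.mul_conjIdeal, B.conjIdeal_of_isAmbiguous h, sq]

end QuadraticBasis

/-! ### Totally positive integers and narrow classes -/

/-- Nonzero integers of `k` that are positive under every real embedding. -/
structure IsTotPos {k : Type*} [Field k] (x : 𝓞 k) : Prop where
  ne_zero : x ≠ 0
  pos : ∀ φ : k →+* ℝ, 0 < φ (algebraMap (𝓞 k) k x)

section

variable {k : Type*} [Field k]

theorem isTotPos_int [NumberField k] {m : ℤ} (hm : 0 < m) : IsTotPos (m : 𝓞 k) :=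
  ⟨by exact_mod_cast hm.ne', fun φ => by simpa using hm⟩

theorem isTotPos_one [NumberField k] : IsTotPos (1 : 𝓞 k) := by simpa using isTotPos_int (k := k) one_pos

theorem IsTotPos.mul {x y : 𝓞 k} (hx : IsTotPos x) (hy : IsTotPos y) : IsTotPos (x * y) :=
  ⟨mul_ne_zero hx.ne_zero hy.ne_zero, fun φ => by
    rw [map_mul, map_mul]; exact mul_pos (hx.pos φ) (hy.pos φ)⟩

theorem isTotPos_sq {x : 𝓞 k} (hx : x ≠ 0) : IsTotPos (x * x) :=
  ⟨mul_ne_zero hx hx, fun φ => by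
    rw [map_mul, map_mul]
    refine mul_self_pos.mpr ?_
    simpa using hx⟩

theorem IsTotPos.of_mul {x y : 𝓞 k} (hx : IsTotPos x) (hxy : IsTotPos (x * y)) : IsTotPos y :=
  ⟨right_ne_zero_of_mul hxy.ne_zero, fun φ => by
    have := hxy.pos φ
    rw [map_mul, map_mul] at this
    exact pos_of_mul_pos_right this (hx.pos φ).le⟩

theorem IsTotPos.span_mem {x : 𝓞 k} (hx : IsTotPos x) :
    Ideal.span {x} ∈ (Ideal (𝓞 k))⁰ := by
  rw [mem_nonZeroDivisors_iff_ne_zero, Ideal.zero_eq_bot, Ne, Ideal.span_singleton_eq_bot]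
  exact hx.ne_zero

variable [NumberField k]

theorem narrowClass_mul (I J : (Ideal (𝓞 k))⁰) :
    narrowClass k (I * J) = narrowClass k I * narrowClass k J := by
  rw [narrowClass, map_mul, map_mul]; rfl

theorem narrowClass_one : narrowClass k 1 = 1 := by
  rw [narrowClass, map_one, map_one]

theorem narrowClass_eq_one_of_span {x : 𝓞 k} (hx : IsTotPos x) {I : (Ideal (𝓞 k))⁰}
    (h : (I : Ideal (𝓞 k)) = Ideal.span {x}) : narrowClass k I = 1 := by
  refine (QuotientGroup.eq_one_iff (N := (totallyPositiveUnits k).map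
    (toPrincipalIdeal (𝓞 k) k)) (FractionalIdeal.mk0 k I)).mpr ?_
  refine ⟨Units.mk0 (algebraMap (𝓞 k) k x) (by simpa using hx.ne_zero), hx.pos, ?_⟩
  rw [toPrincipalIdeal_eq_iff, FractionalIdeal.coe_mk0, h,
    FractionalIdeal.coeIdeal_span_singleton, Units.val_mk0]

theorem narrowClass_eq_of_mul_eq {x y : 𝓞 k} (hx : IsTotPos x) (hy : IsTotPos y)
    {I J : (Ideal (𝓞 k))⁰}
    (h : Ideal.span {x} * (I : Ideal (𝓞 k)) = Ideal.span {y} * (J : Ideal (𝓞 k))) :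
    narrowClass k I = narrowClass k J := by
  have key : (⟨_, hx.span_mem⟩ : (Ideal (𝓞 k))⁰) * I = ⟨_, hy.span_mem⟩ * J := Subtype.ext h
  have := congrArg (narrowClass k) key
  rwa [narrowClass_mul, narrowClass_mul, narrowClass_eq_one_of_span hx (I := ⟨_, hx.span_mem⟩) rfl,
    narrowClass_eq_one_of_span hy (I := ⟨_, hy.span_mem⟩) rfl, one_mul, one_mul] at this

theorem narrowClass_surjective (c : NarrowClassGroup k) : ∃ I, narrowClass k I = c := by
  obtain ⟨J, rfl⟩ : ∃ J, narrowClassMk k J = c := QuotientGroup.mk'_surjective _ c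
  obtain ⟨a, I, ha, h⟩ := FractionalIdeal.exists_eq_spanSingleton_mul (J : FractionalIdeal (𝓞 k)⁰ k)
  have hI : I ≠ ⊥ := by
    rintro rfl
    refine J.ne_zero ?_
    rw [h]; simp
  -- The ideal `aI` equals `a²J`. The factor is `a²` because `a` itself need not be totally
  -- positive.
  have hmem : Ideal.span {a} * I ∈ (Ideal (𝓞 k))⁰ := by
    rw [mem_nonZeroDivisors_iff_ne_zero]
    refine mul_ne_zero ?_ hI
    rwa [Ideal.zero_eq_bot, Ne, Ideal.span_singleton_eq_bot]
  have ha' : algebraMap (𝓞 k) k a ≠ 0 := by simpa using ha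
  refine ⟨⟨_, hmem⟩, ?_⟩
  have key : FractionalIdeal.mk0 k ⟨_, hmem⟩
      = FractionalIdeal.mk0 k ⟨_, (isTotPos_sq ha).span_mem⟩ * J := by
    ext1
    rw [Units.val_mul, FractionalIdeal.coe_mk0, FractionalIdeal.coe_mk0, h,
      FractionalIdeal.coeIdeal_mul, FractionalIdeal.coeIdeal_span_singleton,
      FractionalIdeal.coeIdeal_span_singleton, ← mul_assoc,
      FractionalIdeal.spanSingleton_mul_spanSingleton, map_mul, mul_assoc, mul_inv_cancel₀ ha',
      mul_one]
  have h1 := narrowClass_eq_one_of_span (isTotPos_sq ha) (I := ⟨_, (isTotPos_sq ha).span_mem⟩) rfl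
  rw [narrowClass] at h1 ⊢
  rw [key, map_mul, h1, one_mul]

end

/-! ### Real embeddings and the sign of the norm. -/

namespace QuadraticBasis

variable {k : Type*} [Field k] [NumberField k] {Δ : ℤ} (B : QuadraticBasis k Δ)

theorem four_mul_norm (i j : ℤ) :
    4 * (i ^ 2 + B.t * i * j + B.n * j ^ 2) = (2 * i + B.t * j) ^ 2 - Δ * j ^ 2 := by
  linear_combination -j ^ 2 * B.disc

/-- Every complex embedding is real, since `(2ω - t)² = Δ > 0` forces the image of `ω` onto the real
line. -/
theorem exists_realEmbedding (B : QuadraticBasis k Δ) (hΔ : 0 < Δ) : Nonempty (k →+* ℝ) := by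
  obtain ⟨ψ⟩ : Nonempty (k →+* ℂ) := inferInstance
  set z := ψ (algebraMap (𝓞 k) k B.ω) with hz
  have h0 : z ^ 2 = B.t * z - B.n := by
    have := congrArg (fun x => ψ (algebraMap (𝓞 k) k x)) B.ω_sq
    simpa using this
  have h1 : (2 * z - B.t) ^ 2 = ((Δ : ℝ) : ℂ) := by
    have hd : (B.t : ℂ) ^ 2 - 4 * B.n = Δ := by exact_mod_cast congrArg (Int.cast : ℤ → ℂ) B.disc
    push_cast
    linear_combination 4 * h0 + hd
  have him : z.im = 0 := by
    have hr := congrArg Complex.re h1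
    have hi := congrArg Complex.im h1
    simp [sq] at hr hi
    have hΔ' : (0 : ℝ) < Δ := by exact_mod_cast hΔ
    by_contra h
    have : 2 * z.re - B.t = 0 := by
      have : (2 * z.re - B.t) * z.im = 0 := by linarith
      exact (mul_eq_zero.mp this).resolve_right h
    rw [this] at hr
    nlinarith [mul_self_nonneg z.im]
  have hreal : ComplexEmbedding.IsReal ψ := by
    rw [ComplexEmbedding.isReal_iff]
    apply IsLocalization.ringHom_ext (𝓞 k)⁰
    ext x
    obtain ⟨i, j, rfl⟩ := B.exists_rep x
    simp [ComplexEmbedding.conjugate, ← hz, Complex.conj_eq_iff_im.mpr him]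
  exact ⟨hreal.embedding⟩

/-- Both embeddings send `ω` to a root of `X² - tX + n`, whose roots are `φ(ω)` and `t - φ(ω)`. -/
theorem embedding_eq_or (φ ψ : k →+* ℝ) (x : 𝓞 k) :
    ψ (algebraMap (𝓞 k) k x) = φ (algebraMap (𝓞 k) k x) ∨
      ψ (algebraMap (𝓞 k) k x) = φ (algebraMap (𝓞 k) k (B.conjInt x)) := by
  have h : ∀ χ : k →+* ℝ, χ (algebraMap (𝓞 k) k B.ω) ^ 2
      = B.t * χ (algebraMap (𝓞 k) k B.ω) - B.n := by
    intro χ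
    have := congrArg (fun x => χ (algebraMap (𝓞 k) k x)) B.ω_sq
    simpa using this
  have h1 : (ψ (algebraMap (𝓞 k) k B.ω) - φ (algebraMap (𝓞 k) k B.ω)) *
      (ψ (algebraMap (𝓞 k) k B.ω) - (B.t - φ (algebraMap (𝓞 k) k B.ω))) = 0 := by
    linear_combination h ψ - h φ
  obtain ⟨i, j, rfl⟩ := B.exists_rep x
  rcases mul_eq_zero.mp h1 with h2 | h2
  · left; simp [sub_eq_zero.mp h2]
  · right; simp [sub_eq_zero.mp h2, B.conjInt_ω]

theorem _root_.IsTotPos.conjInt {x : 𝓞 k} (hx : IsTotPos x) : IsTotPos (B.conjInt x) :=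
  ⟨by simpa using hx.ne_zero, fun φ => hx.pos (φ.comp (B.conj : k →+* k))⟩

theorem _root_.IsTotPos.exists_norm_pos {x : 𝓞 k} (hx : IsTotPos x) :
    ∃ m : ℤ, 0 < m ∧ x * B.conjInt x = m := by
  obtain ⟨i, j, -, -, hN⟩ := B.exists_trace_norm x
  refine ⟨_, ?_, hN⟩
  have h4 := B.four_mul_norm i j
  set m := i ^ 2 + B.t * i * j + B.n * j ^ 2
  have hm0 : m ≠ 0 := by
    intro h0
    rw [h0, Int.cast_zero] at hN
    exact (hx.mul (hx.conjInt B)).ne_zero hN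
  by_contra hm
  -- For `Δ ≤ 0` the norm form is nonnegative, so a negative norm needs `Δ > 0`. A real embedding
  -- then exists and contradicts total positivity.
  have hΔ : 0 < Δ := by
    by_contra hΔ
    have : m < 0 := by omega
    nlinarith [sq_nonneg (2 * i + B.t * j), mul_nonneg (neg_nonneg.mpr (not_lt.mp hΔ)) (sq_nonneg j)]
  obtain ⟨φ⟩ := B.exists_realEmbedding hΔ
  have := (hx.mul (hx.conjInt B)).pos φ
  rw [hN, map_intCast, map_intCast] at this
  exact hm (by exact_mod_cast this)

/-- Under one real embedding `x` and its conjugate have equal signs, and any other real embedding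
takes one of these two values on `x`. Without real embeddings only `x ≠ 0` matters. -/
theorem isTotPos_or_neg {x : 𝓞 k} {m : ℤ} (hm : 0 < m) (h : x * B.conjInt x = m) :
    IsTotPos x ∨ IsTotPos (-x) := by
  have hx0 : x ≠ 0 := by
    rintro rfl
    rw [zero_mul] at h
    exact hm.ne (by exact_mod_cast h)
  by_cases he : Nonempty (k →+* ℝ)
  · obtain ⟨φ⟩ := he
    have hp : 0 < φ (algebraMap (𝓞 k) k x) * φ (algebraMap (𝓞 k) k (B.conjInt x)) := by
      rw [← map_mul, ← map_mul, h, map_intCast, map_intCast]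
      exact_mod_cast hm
    rcases mul_pos_iff.mp hp with ⟨h1, h2⟩ | ⟨h1, h2⟩
    · refine Or.inl ⟨hx0, fun ψ => ?_⟩
      rcases B.embedding_eq_or φ ψ x with h3 | h3 <;> rw [h3] <;> assumption
    · refine Or.inr ⟨neg_ne_zero.mpr hx0, fun ψ => ?_⟩
      rw [map_neg, map_neg, neg_pos]
      rcases B.embedding_eq_or φ ψ x with h3 | h3 <;> rw [h3] <;> assumption
  · exact Or.inl ⟨hx0, fun φ => (he ⟨φ⟩).elim⟩

theorem exists_mul_eq_of_narrowClass_eq (B : QuadraticBasis k Δ) {I J : (Ideal (𝓞 k))⁰}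
    (h : narrowClass k I = narrowClass k J) : ∃ (x : 𝓞 k) (m : ℤ), IsTotPos x ∧ 0 < m ∧
      Ideal.span {x} * (I : Ideal (𝓞 k)) = Ideal.span {(m : 𝓞 k)} * (J : Ideal (𝓞 k)) := by
  obtain ⟨u, hu, hu'⟩ := QuotientGroup.eq.mp h
  rw [eq_inv_mul_iff_mul_eq] at hu'
  have hu2 := congrArg Units.val hu'
  rw [Units.val_mul, FractionalIdeal.coe_mk0, FractionalIdeal.coe_mk0, coe_toPrincipalIdeal] at hu2
  obtain ⟨a, b, hb, hab⟩ := IsFractionRing.div_surjective (A := 𝓞 k) (u : k)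
  have hb0 : b ≠ 0 := nonZeroDivisors.ne_zero hb
  have hb' : algebraMap (𝓞 k) k b ≠ 0 := by simpa using hb0
  obtain ⟨N, hN⟩ := B.exists_int_mul_conjInt b
  have hN0 : N ≠ 0 := by
    rintro rfl
    rw [Int.cast_zero] at hN
    exact mul_ne_zero hb0 (by simpa using hb0) hN
  have hNk : algebraMap (𝓞 k) k b * algebraMap (𝓞 k) k (B.conjInt b) = N := by
    rw [← map_mul, hN, map_intCast]
  -- Multiplying `u = a/b` by `N = b b̄` clears the denominator. The second factor `N` makes the
  -- multiplier positive whatever the sign of `N`.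
  have hx : algebraMap (𝓞 k) k (a * B.conjInt b * N) = u * ((N * N : ℤ) : k) := by
    rw [← hab]
    push_cast
    rw [← hNk]
    simp only [map_intCast, ← hNk]
    field_simp
  have hNN : 0 < N * N := mul_self_pos.mpr hN0
  refine ⟨a * B.conjInt b * N, N * N, ⟨?_, fun φ => ?_⟩, hNN, ?_⟩
  · intro h0
    rw [h0, map_zero] at hx
    have : ((N * N : ℤ) : k) ≠ 0 := by exact_mod_cast hNN.ne'
    exact mul_ne_zero u.ne_zero this hx.symm
  · rw [hx, map_mul, map_intCast]
    exact mul_pos (hu φ) (by exact_mod_cast hNN)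
  · apply FractionalIdeal.coeIdeal_injective (K := k)
    beta_reduce
    rw [FractionalIdeal.coeIdeal_mul, FractionalIdeal.coeIdeal_mul,
      FractionalIdeal.coeIdeal_span_singleton, FractionalIdeal.coeIdeal_span_singleton, hx, ← hu2,
      mul_comm (u : k), ← FractionalIdeal.spanSingleton_mul_spanSingleton, map_intCast]
    ring

end QuadraticBasis

/-! ### Ideals with a rational square -/

/-- Here `aU` and `aM` are the trace and norm of `i + ω`. The coprimality of `a` and `M` is what
makes the square of `(a, i + ω)` equal to `(a)`. -/
theorem exists_dvd_trace_coprime_norm {d t n a : ℤ} (hd : Squarefree d)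
    (ht : t ^ 2 - 4 * n = pellDisc d) (ha : IsDescendantIndex (pellDisc d) a) :
    ∃ i M U : ℤ, 2 * i + t = a * U ∧ i ^ 2 + t * i + n = a * M ∧ IsCoprime a M := by
  have hco : ∀ {f e : ℤ}, d = f * e → IsCoprime f e := fun {f e} h => by
    rw [h] at hd
    exact (squarefree_mul_iff.mp hd).1.isCoprime
  have hdvd := ha.dvd
  rcases pellDisc_eq d with ⟨h1, h'⟩ | ⟨h1, h'⟩
  · rw [h'] at hdvd ht
    obtain ⟨e, he⟩ := hdvd
    have hdodd : ¬ Even d := by rw [Int.even_iff]; omega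
    have haodd : Odd a := by
      rw [← Int.not_even_iff_odd]
      intro h
      exact hdodd (he ▸ h.mul_right e)
    have htodd : Odd t := by
      rcases Int.sq_emod_four t with ⟨_, h⟩ | ⟨h, _⟩
      · omega
      · exact Int.odd_iff.mpr h
    -- The trace is chosen to be `a`; with `d = ae` the norm is then `a(a - e)/4`, and `a - e` is
    -- coprime to `a`.
    obtain ⟨i, hi⟩ := haodd.sub_odd htodd
    have hN : 4 * (i ^ 2 + t * i + n) = a * (a - e) := by
      have : a = 2 * i + t := by linarith
      linear_combination (-a - 2 * i - t) * this - ht - he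
    have hcop4 : IsCoprime a (2 ^ 2) := (Int.isCoprime_two_right.mpr haodd).pow_right
    obtain ⟨M, hM⟩ : a ∣ i ^ 2 + t * i + n := hcop4.dvd_of_dvd_mul_left ⟨_, by rw [← hN]; ring⟩
    refine ⟨i, M, 1, by linarith, hM, ?_⟩
    have h4M : 4 * M = a - e := by
      apply mul_left_cancel₀ ha.pos.ne'
      rw [← hN, hM]; ring
    have : IsCoprime a (4 * M) := by
      rw [h4M]
      have := (hco he).neg_right.add_mul_left_right 1
      rwa [mul_one, neg_add_eq_sub] at this
    exact this.of_mul_right_right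
  · rw [h'] at hdvd ht
    obtain ⟨t', rfl⟩ : ∃ t', t = 2 * t' := by
      rcases Int.sq_emod_four t with ⟨h, _⟩ | ⟨_, h⟩
      · exact ⟨t / 2, by omega⟩
      · omega
    have hn : n = t' ^ 2 - d := by linarith
    -- If `d = ae`, the element `√d` of trace 0 and norm `-ae` works. Otherwise `a = 2f` with `d =
    -- fe ≡ 3` mod 4, and `f + √d` has trace `a` and norm `f(f - e)`, where `f - e ≡ 2` mod 4.
    by_cases hadvd : a ∣ d
    · obtain ⟨e, he⟩ := hadvd
      refine ⟨-t', -e, 0, by ring, by linear_combination hn - he, (hco he).neg_right⟩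
    · have heven : Even a := by
        by_contra h
        rw [Int.not_even_iff_odd] at h
        exact hadvd (((Int.isCoprime_two_right.mpr h).pow_right (n := 2)).dvd_of_dvd_mul_left hdvd)
      obtain ⟨f, rfl⟩ := heven.two_dvd
      have hfodd : Odd f := by
        rw [← Int.not_even_iff_odd]
        intro h
        obtain ⟨g, rfl⟩ := h.two_dvd
        exact ha.squarefree.not_four_dvd ⟨g, by ring⟩
      have hfd : f ∣ d := ((Int.isCoprime_two_right.mpr hfodd).pow_right (n := 2)).dvd_of_dvd_mul_left
        ((Dvd.intro_left 2 rfl).trans hdvd)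
      have hdodd : Odd d := by
        rw [← Int.not_even_iff_odd]
        intro h
        exact hadvd ((Int.isCoprime_two_right.mpr hfodd).symm.mul_dvd h.two_dvd hfd)
      obtain ⟨e, he⟩ := hfd
      have hmod : (f - e) % 4 = 2 := by
        have h3 : (f * e) % 4 = 3 := by
          rw [← he]
          have := Int.odd_iff.mp hdodd
          omega
        have h5 : f % 4 = 0 ∨ f % 4 = 1 ∨ f % 4 = 2 ∨ f % 4 = 3 := by omega
        have h6 : e % 4 = 0 ∨ e % 4 = 1 ∨ e % 4 = 2 ∨ e % 4 = 3 := by omega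
        rw [Int.mul_emod] at h3
        rcases h5 with h5 | h5 | h5 | h5 <;> rcases h6 with h6 | h6 | h6 | h6 <;>
          rw [h5, h6] at h3 <;> omega
      obtain ⟨M, hM⟩ : ∃ M, f - e = 2 * M := ⟨(f - e) / 2, by omega⟩
      have hModd : Odd M := Int.odd_iff.mpr (by omega)
      refine ⟨f - t', M, 1, by ring, ?_, IsCoprime.mul_left (Int.isCoprime_two_right.mpr hModd).symm ?_⟩
      · linear_combination hn - he + f * hM
      · have : IsCoprime f (2 * M) := by
          rw [← hM]
          have := (hco he).neg_right.add_mul_left_right 1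
          rwa [mul_one, neg_add_eq_sub] at this
        exact this.of_mul_right_right

namespace QuadraticBasis

variable {k : Type*} [Field k] [NumberField k] {Δ : ℤ} (B : QuadraticBasis k Δ)

theorem sq_eq_trace_mul_sub_norm {x u N : 𝓞 k} (hu : x + B.conjInt x = u)
    (hN : x * B.conjInt x = N) : x ^ 2 = u * x - N := by
  linear_combination x * hu - hN

/-- Take `I = (a, x)` with `x = i + ω`. Its square is generated by `a²`, `ax` and `x² = a(Ux - M)`,
all multiples of `a`. From `αa + βM = 1` one recovers `a = αa² + β(U·ax - x²)`. -/
theorem exists_sq_eq {d a : ℤ} (B : QuadraticBasis k (pellDisc d)) (hd : Squarefree d)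
    (ha : IsDescendantIndex (pellDisc d) a) :
    ∃ I : (Ideal (𝓞 k))⁰, (I : Ideal (𝓞 k)) ^ 2 = Ideal.span {(a : 𝓞 k)} := by
  obtain ⟨i, M, U, hU, hM, α, β, hαβ⟩ := exists_dvd_trace_coprime_norm hd B.disc ha
  set x : 𝓞 k := i + B.ω with hx
  have hx2 : x ^ 2 = a * (U * x - M) := by
    have h1 : (2 * i + B.t : 𝓞 k) = a * U := by exact_mod_cast congrArg (Int.cast : ℤ → 𝓞 k) hU
    have h2 : (i ^ 2 + B.t * i + B.n : 𝓞 k) = a * M := by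
      exact_mod_cast congrArg (Int.cast : ℤ → 𝓞 k) hM
    linear_combination B.ω_sq + x * h1 - h2
  have h3 : (α * a + β * M : 𝓞 k) = 1 := by exact_mod_cast congrArg (Int.cast : ℤ → 𝓞 k) hαβ
  have hI : (Ideal.span {(a : 𝓞 k), x}) ^ 2 = Ideal.span {(a : 𝓞 k)} := by
    rw [sq]
    have hma : (a : 𝓞 k) ∈ Ideal.span {(a : 𝓞 k), x} := Ideal.subset_span (by simp)
    have hmx : x ∈ Ideal.span {(a : 𝓞 k), x} := Ideal.subset_span (by simp)
    apply le_antisymm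
    · rw [Ideal.span_mul_span', Ideal.span_le]
      rintro _ ⟨y, hy, z, hz, rfl⟩
      simp only [Set.mem_insert_iff, Set.mem_singleton_iff] at hy hz
      simp only [SetLike.mem_coe, Ideal.mem_span_singleton]
      rcases hy with rfl | rfl
      · exact Dvd.intro _ rfl
      · rcases hz with rfl | rfl
        · exact Dvd.intro_left _ rfl
        · exact ⟨_, by rw [← hx2, sq]⟩
    · rw [Ideal.span_singleton_le_iff_mem]
      have : (a : 𝓞 k) = α * (a * a) + β * (U * (a * x) - x * x) := by
        linear_combination (-a : 𝓞 k) * h3 + β * hx2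
      refine (congrArg (· ∈ _) this).mpr ?_
      exact add_mem (Ideal.mul_mem_left _ _ (Ideal.mul_mem_mul hma hma))
        (Ideal.mul_mem_left _ _ (sub_mem (Ideal.mul_mem_left _ _ (Ideal.mul_mem_mul hma hmx))
          (Ideal.mul_mem_mul hmx hmx)))
  refine ⟨⟨_, mem_nonZeroDivisors_iff_ne_zero.mpr fun h0 => ?_⟩, hI⟩
  change Ideal.span {(a : 𝓞 k), x} = 0 at h0
  have : (a : 𝓞 k) ∈ Ideal.span {(a : 𝓞 k), x} := Ideal.subset_span (by simp)
  rw [h0, Ideal.zero_eq_bot, Ideal.mem_bot] at this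
  exact ha.pos.ne' (by exact_mod_cast this)

theorem int_dvd_iff (g i j : ℤ) : (g : 𝓞 k) ∣ i + j * B.ω ↔ g ∣ i ∧ g ∣ j := by
  constructor
  · rintro ⟨y, hy⟩
    obtain ⟨p, q, rfl⟩ := B.exists_rep y
    have := B.coord_zero (i - g * p) (j - g * q) (by push_cast; linear_combination hy)
    exact ⟨⟨p, by linarith [this.1]⟩, ⟨q, by linarith [this.2]⟩⟩
  · rintro ⟨⟨p, rfl⟩, ⟨q, rfl⟩⟩
    exact ⟨p + q * B.ω, by push_cast; ring⟩

theorem int_dvd_int_iff (B : QuadraticBasis k Δ) (g i : ℤ) : (g : 𝓞 k) ∣ i ↔ g ∣ i := by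
  have := B.int_dvd_iff g i 0
  simpa using this

/-- A squarefree `g` prime to `Δ` is unramified, so `(g)` is a squarefree ideal. In coordinates: `g`
divides the norm `N`, then the trace `u` through `x² = ux - N`, then `j` through `Δj² = u² - 4N`,
and finally `i`. -/
theorem int_dvd_of_dvd_sq (B : QuadraticBasis k Δ) {g : ℤ} (hg : Squarefree g) (hgΔ : IsCoprime g Δ) {x : 𝓞 k}
    (h : (g : 𝓞 k) ∣ x ^ 2) : (g : 𝓞 k) ∣ x := by
  obtain ⟨i, j, hx, htr, hN⟩ := B.exists_trace_norm x
  have h4 := B.four_mul_norm i j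
  set N := i ^ 2 + B.t * i * j + B.n * j ^ 2 with hNdef
  set u := 2 * i + B.t * j with hudef
  have hgN : g ∣ N := by
    obtain ⟨y, hy⟩ := h
    obtain ⟨p, hp⟩ := B.exists_int_mul_conjInt y
    have h1 : ((g ^ 2 * p : ℤ) : 𝓞 k) = ((N ^ 2 : ℤ) : 𝓞 k) := by
      have hy' := congrArg B.conjInt hy
      rw [map_pow, map_mul, map_intCast] at hy'
      push_cast
      rw [← hN, ← hp, mul_pow, hy, hy']
      ring
    have h2 : g ^ 2 * p = N ^ 2 := by exact_mod_cast h1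
    exact (Int.pow_dvd_pow_iff two_ne_zero).mp ⟨p, h2.symm⟩
  have hgu : g ∣ u := by
    have h1 : (g : 𝓞 k) ∣ ((u * i : ℤ) : 𝓞 k) + ((u * j : ℤ) : 𝓞 k) * B.ω := by
      have h2 := B.sq_eq_trace_mul_sub_norm htr hN
      have h3 : ((u * i : ℤ) : 𝓞 k) + ((u * j : ℤ) : 𝓞 k) * B.ω = x ^ 2 + (N : 𝓞 k) := by
        rw [h2, hx]; push_cast; ring
      rw [h3]
      exact dvd_add h ((B.int_dvd_int_iff g N).mpr hgN)
    obtain ⟨h2, h3⟩ := (B.int_dvd_iff _ _ _).mp h1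
    refine (hg.dvd_pow_iff_dvd two_ne_zero).mp ?_
    have : u ^ 2 = 2 * (u * i) + B.t * (u * j) := by rw [hudef]; ring
    rw [this]
    exact dvd_add (h2.mul_left _) (h3.mul_left _)
  have hgj : g ∣ j := by
    refine (hg.dvd_pow_iff_dvd two_ne_zero).mp ?_
    refine hgΔ.dvd_of_dvd_mul_left ?_
    have : Δ * j ^ 2 = u * u - 4 * N := by linarith
    rw [this]
    exact dvd_sub (hgu.mul_left _) (hgN.mul_left _)
  have hgi : g ∣ i := by
    refine (hg.dvd_pow_iff_dvd two_ne_zero).mp ?_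
    have : i ^ 2 = N - (B.t * i + B.n * j) * j := by rw [hNdef]; ring
    rw [this]
    exact dvd_sub hgN (hgj.mul_left _)
  rw [hx, B.int_dvd_iff]
  exact ⟨hgi, hgj⟩

/-- Let `g = a / gcd(a, Δ)`, which is prime to `Δ`. Each `x ∈ I` has `g ∣ x²`, hence `g ∣ x`. So `I
⊆ (g)` and `g² ∣ a`, which makes `g` a unit. -/
theorem dvd_disc_of_sq_eq (B : QuadraticBasis k Δ) {a : ℤ} (ha : Squarefree a) {I : Ideal (𝓞 k)}
    (hI : I ^ 2 = Ideal.span {(a : 𝓞 k)}) : a ∣ Δ := by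
  obtain ⟨g, hg⟩ := Int.gcd_dvd_left a Δ
  have hgΔ : IsCoprime g Δ := by
    have hrp : IsCoprime g (Int.gcd a Δ) := by
      rw [hg] at ha
      exact (squarefree_mul_iff.mp ha).1.isCoprime.symm
    rw [Int.isCoprime_iff_gcd_eq_one] at hrp ⊢
    have h1 : ((Int.gcd g Δ : ℕ) : ℤ) ∣ Int.gcd g (Int.gcd a Δ) := by
      refine Int.dvd_coe_gcd (Int.gcd_dvd_left _ _) (Int.dvd_coe_gcd ?_ (Int.gcd_dvd_right _ _))
      rw [hg]
      exact (Int.gcd_dvd_left _ _).mul_left _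
    rw [hrp] at h1
    exact Nat.dvd_one.mp (by exact_mod_cast h1)
  have hsg : Squarefree g := ha.squarefree_of_dvd ⟨_, by rw [mul_comm]; exact hg⟩
  have hga : (g : 𝓞 k) ∣ a := by
    rw [hg]; push_cast; exact Dvd.intro_left _ rfl
  have hle : I ≤ Ideal.span {(g : 𝓞 k)} := by
    intro x hx
    rw [Ideal.mem_span_singleton]
    apply B.int_dvd_of_dvd_sq hsg hgΔ
    have : x ^ 2 ∈ I ^ 2 := Ideal.pow_mem_pow hx 2
    rw [hI, Ideal.mem_span_singleton] at this
    exact hga.trans this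
  have hle2 : I ^ 2 ≤ Ideal.span {(g : 𝓞 k)} ^ 2 := Ideal.pow_right_mono hle 2
  rw [hI, Ideal.span_singleton_pow, Ideal.span_singleton_le_span_singleton, ← Int.cast_pow,
    B.int_dvd_int_iff, sq] at hle2
  have hu := ha g hle2
  have : a ∣ Int.gcd a Δ := by
    nth_rewrite 1 [hg]
    rw [hu.mul_right_dvd]
  exact this.trans (Int.gcd_dvd_right _ _)

end QuadraticBasis

/-! ### Rational and integral points and the narrow classes of ambiguous ideals -/

theorem IsDescendantIndex.mul_ediv {Δ a : ℤ} (ha : IsDescendantIndex Δ a) : a * (Δ / a) = Δ :=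
  Int.mul_ediv_cancel' ha.dvd

namespace QuadraticBasis

variable {k : Type*} [Field k] [NumberField k] {Δ : ℤ} (B : QuadraticBasis k Δ)

theorem conjIdeal_of_sq_eq {I : Ideal (𝓞 k)} {a : ℤ} (h : I ^ 2 = Ideal.span {(a : 𝓞 k)}) :
    B.conjIdeal I = I :=
  B.conjIdeal_of_isAmbiguous (isAmbiguous_of_sq_eq h)

theorem absNorm_pos (I : (Ideal (𝓞 k))⁰) : (0 : ℤ) < Ideal.absNorm (I : Ideal (𝓞 k)) := by
  have := Ideal.absNorm_ne_zero_of_nonZeroDivisors I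
  omega

/-- If the norm of an ambiguous ideal is the norm of an element up to a rational square, then its
narrow class is a square. -/
theorem exists_narrowClass_eq_sq {a : ℤ} {I : (Ideal (𝓞 k))⁰}
    (hI : (I : Ideal (𝓞 k)) ^ 2 = Ideal.span {(a : 𝓞 k)}) {x : 𝓞 k} (hx : IsTotPos x) {m : ℤ}
    (hm : 0 < m) (hN : x * B.conjInt x = ((m ^ 2 * a : ℤ) : 𝓞 k)) :
    ∃ c, narrowClass k I = c ^ 2 := by
  -- Since `(mI)² = (x x̄)`, conjugating this sum gives `mI · J̄ = x̄J`. Multiplying by `J` turns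
  -- `J̄J` into `(N J)`, so `I` lies in the narrow class of `J²`.
  set J : Ideal (𝓞 k) := Ideal.span {x} ⊔ Ideal.span {(m : 𝓞 k)} * I with hJ
  have hJ0 : J ∈ (Ideal (𝓞 k))⁰ := by
    rw [mem_nonZeroDivisors_iff_ne_zero]
    intro h0
    have : x ∈ J := (le_sup_left : _ ≤ J) (Ideal.mem_span_singleton_self x)
    rw [h0, Ideal.zero_eq_bot, Ideal.mem_bot] at this
    exact hx.ne_zero this
  have key : Ideal.span {(m : 𝓞 k)} * I * B.conjIdeal J = Ideal.span {B.conjInt x} * J := by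
    have h1 : Ideal.span {(m : 𝓞 k)} * I * (Ideal.span {(m : 𝓞 k)} * I)
        = Ideal.span {B.conjInt x} * Ideal.span {x} := by
      calc _ = Ideal.span {(m : 𝓞 k)} ^ 2 * (I : Ideal (𝓞 k)) ^ 2 := by ring
        _ = _ := by
          rw [hI, Ideal.span_singleton_pow, Ideal.span_singleton_mul_span_singleton,
            Ideal.span_singleton_mul_span_singleton, mul_comm (B.conjInt x), hN]
          push_cast
          rfl
    rw [hJ, B.conjIdeal_sup, B.conjIdeal_span, B.conjIdeal_mul, B.conjIdeal_span_int,
      B.conjIdeal_of_sq_eq hI, Ideal.mul_sup, Ideal.mul_sup, h1, sup_comm]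
    congr 1
    exact mul_comm _ _
  refine ⟨narrowClass k ⟨J, hJ0⟩, ?_⟩
  rw [sq, ← narrowClass_mul]
  refine narrowClass_eq_of_mul_eq (isTotPos_int (mul_pos hm (absNorm_pos ⟨J, hJ0⟩)))
    (hx.conjInt B) ?_
  rw [Int.cast_mul, ← Ideal.span_singleton_mul_span_singleton, ← B.mul_conjIdeal]
  calc _ = Ideal.span {(m : 𝓞 k)} * I * B.conjIdeal J * J := by ring
    _ = _ := by rw [key]; exact mul_assoc _ _ _

theorem exists_narrowClass_eq_sq_of_point (B : QuadraticBasis k Δ)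
    {a : ℤ} (ha : IsDescendantIndex Δ a)
    {I : (Ideal (𝓞 k))⁰} (hI : (I : Ideal (𝓞 k)) ^ 2 = Ideal.span {(a : 𝓞 k)})
    (hp : (descendantPoints Δ a ℚ).Nonempty) : ∃ c, narrowClass k I = c ^ 2 := by
  obtain ⟨⟨r, s⟩, hrs⟩ := hp
  simp only [descendantPoints, Set.mem_ofPred_eq] at hrs
  obtain ⟨D, R, S, hD, h⟩ : ∃ D R S : ℤ, 0 < D ∧ a * R ^ 2 - Δ / a * S ^ 2 = 4 * D ^ 2 := by
    refine ⟨r.den * s.den, r.num * s.den, s.num * r.den, ?_, ?_⟩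
    · exact_mod_cast Nat.mul_pos r.den_pos s.den_pos
    · have hr : (r.den : ℚ) ≠ 0 := by exact_mod_cast r.den_nz
      have hs : (s.den : ℚ) ≠ 0 := by exact_mod_cast s.den_nz
      have hr' : (r.num : ℚ) = r * r.den := (Rat.mul_den_eq_num r).symm
      have hs' : (s.num : ℚ) = s * s.den := (Rat.mul_den_eq_num s).symm
      have : (a : ℚ) * (r.num * s.den) ^ 2 - ((Δ / a : ℤ) : ℚ) * (s.num * r.den) ^ 2
          = 4 * (r.den * s.den) ^ 2 := by
        rw [hr', hs']
        linear_combination (r.den * s.den : ℚ) ^ 2 * hrs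
      exact_mod_cast this
  -- This is `aR + S√Δ`, with `√Δ = 2ω - t`.
  have hN : ∀ x : 𝓞 k, x = ((a * R - B.t * S : ℤ) : 𝓞 k) + ((2 * S : ℤ) : 𝓞 k) * B.ω →
      x * B.conjInt x = (((2 * D) ^ 2 * a : ℤ) : 𝓞 k) := by
    rintro x rfl
    have h1 : (2 * D) ^ 2 * a = (a * R - B.t * S) ^ 2 + B.t * (a * R - B.t * S) * (2 * S)
        + B.n * (2 * S) ^ 2 := by
      linear_combination -a * h + S ^ 2 * B.disc - S ^ 2 * ha.mul_ediv
    rw [h1]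
    simp only [map_add, map_mul, map_intCast, B.conjInt_ω]
    push_cast
    linear_combination (-(2 * S : 𝓞 k) ^ 2) * B.ω_sq
  have h2D : 0 < 2 * D := by omega
  specialize hN _ rfl
  rcases B.isTotPos_or_neg (mul_pos (pow_pos h2D 2) ha.pos) hN with hx | hx
  · exact B.exists_narrowClass_eq_sq hI hx h2D hN
  · exact B.exists_narrowClass_eq_sq hI hx h2D (by rw [map_neg, neg_mul_neg, hN])

/-- Taking norms in `xI = mJ²` gives `na = (mq)²` with `n = N(x)` and `q = N(J)`. Scaling `4n = u² -
Δj²` by `(mq)²/(n²a)` turns it into the equation of `T_a`. -/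
theorem point_of_narrowClass_eq_sq (B : QuadraticBasis k Δ)
    {a : ℤ} (ha : IsDescendantIndex Δ a)
    {I : (Ideal (𝓞 k))⁰} (hI : (I : Ideal (𝓞 k)) ^ 2 = Ideal.span {(a : 𝓞 k)})
    {c : NarrowClassGroup k} (hc : narrowClass k I = c ^ 2) :
    (descendantPoints Δ a ℚ).Nonempty := by
  obtain ⟨J, rfl⟩ := narrowClass_surjective c
  rw [sq, ← narrowClass_mul] at hc
  obtain ⟨x, m, hx, hm, h⟩ := B.exists_mul_eq_of_narrowClass_eq hc
  obtain ⟨n, hn, hxn⟩ := hx.exists_norm_pos B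
  have h' := congrArg B.conjIdeal h
  rw [B.conjIdeal_mul, B.conjIdeal_mul, B.conjIdeal_span, B.conjIdeal_span_int,
    B.conjIdeal_of_sq_eq hI] at h'
  have hw := absNorm_pos J
  have hJ := B.mul_conjIdeal J
  set q : ℤ := ((Ideal.absNorm (J : Ideal (𝓞 k)) : ℕ) : ℤ)
  have hna : n * a = (m * q) ^ 2 := by
    apply B.eq_of_span_int_eq (mul_pos hn ha.pos) (pow_pos (mul_pos hm hw) 2)
    calc Ideal.span {((n * a : ℤ) : 𝓞 k)}
        = Ideal.span {x} * I * (Ideal.span {B.conjInt x} * I) := by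
          rw [Int.cast_mul, ← Ideal.span_singleton_mul_span_singleton, ← hI, ← hxn,
            ← Ideal.span_singleton_mul_span_singleton]
          ring
      _ = Ideal.span {(m : 𝓞 k)} ^ 2 * (J * B.conjIdeal J) ^ 2 := by
          rw [h, h']
          change Ideal.span {(m : 𝓞 k)} * (J * J) *
            (Ideal.span {(m : 𝓞 k)} * B.conjIdeal (J * J)) = _
          rw [B.conjIdeal_mul]
          ring
      _ = _ := by
          rw [hJ, Ideal.span_singleton_pow, Ideal.span_singleton_pow,
            Ideal.span_singleton_mul_span_singleton, ← mul_pow]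
          push_cast
          rfl
  obtain ⟨i, j, -, -, hN⟩ := B.exists_trace_norm x
  rw [hxn] at hN
  have hN' : n = i ^ 2 + B.t * i * j + B.n * j ^ 2 := by exact_mod_cast hN
  have h4 := B.four_mul_norm i j
  rw [← hN'] at h4
  set u := 2 * i + B.t * j
  have hnQ : (n : ℚ) ≠ 0 := by exact_mod_cast hn.ne'
  have haQ : (a : ℚ) ≠ 0 := by exact_mod_cast ha.pos.ne'
  have h4Q : (4 * n : ℚ) = u ^ 2 - Δ * j ^ 2 := by exact_mod_cast h4
  have hnaQ : (n * a : ℚ) = (m * q) ^ 2 := by exact_mod_cast hna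
  have hΔQ : (a * (Δ / a : ℤ) : ℚ) = Δ := by exact_mod_cast ha.mul_ediv
  refine ⟨(m * q * u / (n * a), m * q * j / n), ?_⟩
  simp only [descendantPoints, Set.mem_ofPred_eq]
  rw [← hΔQ] at h4Q
  generalize ((Δ / a : ℤ) : ℚ) = b at h4Q
  field_simp
  have : (m : ℚ) ^ 2 * q ^ 2 * (u ^ 2 - a * b * j ^ 2) = 4 * (n ^ 2 * a) := by
    rw [← h4Q, ← mul_pow, ← hnaQ]; ring
  linear_combination this

/-- The integer `x = (ar + s√Δ)/2` has trace `ar` and norm `a`, so `x² = a(rx - 1)`. The factor `rx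
- 1` has norm 1, hence `(x)² = (a)` and `I = (x)`. -/
theorem narrowClass_eq_one_of_integral_point (B : QuadraticBasis k Δ)
    {a : ℤ} (ha : IsDescendantIndex Δ a)
    {I : (Ideal (𝓞 k))⁰} (hI : (I : Ideal (𝓞 k)) ^ 2 = Ideal.span {(a : 𝓞 k)})
    (hp : (descendantPoints Δ a ℤ).Nonempty) : narrowClass k I = 1 := by
  obtain ⟨⟨r, s⟩, hrs⟩ := hp
  simp only [descendantPoints, Set.mem_ofPred_eq, Int.cast_id] at hrs
  have h1 : (a * r) ^ 2 = (B.t * s) ^ 2 + 4 * (a - B.n * s ^ 2) := by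
    linear_combination a * hrs + s ^ 2 * ha.mul_ediv - s ^ 2 * B.disc
  obtain ⟨i, hi⟩ : ∃ i, a * r = 2 * i + B.t * s := by
    refine ⟨(a * r - B.t * s) / 2, ?_⟩
    generalize a - B.n * s ^ 2 = q at h1
    rcases Int.sq_emod_four (a * r) with ⟨_, hu⟩ | ⟨_, hu⟩ <;>
      rcases Int.sq_emod_four (B.t * s) with ⟨_, hv⟩ | ⟨_, hv⟩ <;> omega
  have hiN : a = i ^ 2 + B.t * i * s + B.n * s ^ 2 := by
    rw [hi] at h1
    linarith
  set x : 𝓞 k := i + s * B.ω with hx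
  have hcx : B.conjInt x = i + s * (B.t - B.ω) := by simp [hx, B.conjInt_ω]
  have htr : x + B.conjInt x = a * r := by
    have : (a * r : 𝓞 k) = 2 * i + B.t * s := by exact_mod_cast congrArg (Int.cast : ℤ → 𝓞 k) hi
    rw [hcx, this, hx]; ring
  have hN : x * B.conjInt x = a := by
    have : (a : 𝓞 k) = i ^ 2 + B.t * i * s + B.n * s ^ 2 := by
      exact_mod_cast congrArg (Int.cast : ℤ → 𝓞 k) hiN
    rw [hcx, this, hx]; linear_combination (-(s : 𝓞 k) ^ 2) * B.ω_sq
  have hunit : IsUnit (r * x - 1) :=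
    IsUnit.of_mul_eq_one (r * B.conjInt x - 1) (by linear_combination r ^ 2 * hN - r * htr)
  have hsq : Ideal.span {x} ^ 2 = Ideal.span {(a : 𝓞 k)} := by
    have : x ^ 2 = a * (r * x - 1) := by linear_combination x * htr - hN
    rw [Ideal.span_singleton_pow, this, Ideal.span_singleton_mul_right_unit hunit]
  have hIx : (I : Ideal (𝓞 k)) = Ideal.span {x} := Ideal.eq_of_sq_eq_sq (hI.trans hsq.symm)
  rcases B.isTotPos_or_neg ha.pos hN with h | h
  · exact narrowClass_eq_one_of_span h hIx
  · exact narrowClass_eq_one_of_span h (by rw [hIx, Ideal.span_singleton_neg])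

/-- A totally positive generator of `I` has norm `a`, so its trace `u` satisfies `u² = 4a + Δj²`.
Squarefreeness of `a` gives `a ∣ u`, and `r = u/a`. -/
theorem integral_point_of_narrowClass_eq_one (B : QuadraticBasis k Δ)
    {a : ℤ} (ha : IsDescendantIndex Δ a)
    {I : (Ideal (𝓞 k))⁰} (hI : (I : Ideal (𝓞 k)) ^ 2 = Ideal.span {(a : 𝓞 k)})
    (hc : narrowClass k I = 1) : (descendantPoints Δ a ℤ).Nonempty := by
  obtain ⟨x, m, hx, hm, h⟩ := B.exists_mul_eq_of_narrowClass_eq (narrowClass_one.trans hc.symm)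
  have hmk : IsTotPos (m : 𝓞 k) := isTotPos_int hm
  rw [OneMemClass.coe_one, mul_one] at h
  obtain ⟨y, -, rfl⟩ := Ideal.mem_span_singleton_mul.mp (h ▸ Ideal.mem_span_singleton_self x)
  have hy := hmk.of_mul hx
  rw [← Ideal.span_singleton_mul_span_singleton] at h
  have hyI : Ideal.span {y} = (I : Ideal (𝓞 k)) :=
    mul_left_cancel₀ (nonZeroDivisors.ne_zero hmk.span_mem) h
  obtain ⟨n, hn, hyn⟩ := hy.exists_norm_pos B
  have hna : n = a := by
    apply B.eq_of_span_int_eq hn ha.pos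
    rw [← hyn, ← Ideal.span_singleton_mul_span_singleton, ← B.conjIdeal_span, hyI,
      B.conjIdeal_of_sq_eq hI, ← sq, hI]
  obtain ⟨i, j, -, -, hN⟩ := B.exists_trace_norm y
  rw [hyn, hna] at hN
  have hN' : a = i ^ 2 + B.t * i * j + B.n * j ^ 2 := by exact_mod_cast hN
  have h4 := B.four_mul_norm i j
  rw [← hN'] at h4
  have hΔ := ha.mul_ediv
  obtain ⟨r, hr⟩ : a ∣ 2 * i + B.t * j := by
    refine (ha.squarefree.dvd_pow_iff_dvd two_ne_zero).mp ⟨4 + Δ / a * j ^ 2, ?_⟩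
    linear_combination -h4 - j ^ 2 * hΔ
  refine ⟨(r, j), ?_⟩
  simp only [descendantPoints, Set.mem_ofPred_eq, Int.cast_id]
  apply mul_left_cancel₀ ha.pos.ne'
  rw [hr] at h4
  linear_combination -h4 - j ^ 2 * hΔ

/-- Hilbert's Theorem 90 with a totally positive solution. -/
theorem exists_isTotPos_mul_conjInt_eq {x : 𝓞 k} (hx : IsTotPos x) {z : ℤ} (hz : 0 < z)
    (hxz : x * B.conjInt x = z ^ 2) :
    ∃ β : 𝓞 k, IsTotPos β ∧ x * B.conjInt β = z * β := by
  -- The usual solution `z + x` fails only for `x = -z`. Then `√Δ` serves: `-z` being totally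
  -- positive excludes real embeddings.
  by_cases h0 : (z : 𝓞 k) + x = 0
  · have hx' : x = -z := by linear_combination h0
    refine ⟨2 * B.ω - B.t, ⟨fun h => ?_, fun φ => ?_⟩, ?_⟩
    · have := (B.coord_zero (-B.t) 2 (by push_cast; linear_combination h)).2
      omega
    · exfalso
      have := hx.pos φ
      rw [hx', map_neg, map_neg, map_intCast, map_intCast, neg_pos] at this
      exact absurd hz (not_lt.mpr (by exact_mod_cast this.le))
    · rw [hx']
      simp only [map_sub, map_mul, map_ofNat, map_intCast, B.conjInt_ω]
      ring
  · refine ⟨z + x, ⟨h0, fun φ => ?_⟩, ?_⟩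
    · rw [map_add, map_add]
      exact add_pos ((isTotPos_int hz).pos φ) (hx.pos φ)
    · rw [map_add, map_intCast]
      linear_combination hxz

/-- From `(x) = mC²` follow `zC = xC̄` and `N(x) = z²` with `z = m·N(C)`. If `x β̄ = zβ`, then `D =
β̄C` is invariant, because `zD̄ = zβC̄ = β̄xC̄ = zD`. So `D² = (N D)`, and dividing `D` by the
square part of its norm leaves `I`. -/
theorem exists_sq_eq_of_narrowClass_sq_eq_one (B : QuadraticBasis k Δ)
    {c : NarrowClassGroup k} (hc : c ^ 2 = 1) :
    ∃ (a : ℤ) (I : (Ideal (𝓞 k))⁰), IsDescendantIndex Δ a ∧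
      (I : Ideal (𝓞 k)) ^ 2 = Ideal.span {(a : 𝓞 k)} ∧ narrowClass k I = c := by
  obtain ⟨C, rfl⟩ := narrowClass_surjective c
  rw [sq, ← narrowClass_mul] at hc
  obtain ⟨x, m, hx, hm, h⟩ := B.exists_mul_eq_of_narrowClass_eq (narrowClass_one.trans hc.symm)
  rw [OneMemClass.coe_one, mul_one] at h
  change Ideal.span {x} = Ideal.span {(m : 𝓞 k)} * (C * C) at h
  have hC0 : (C : Ideal (𝓞 k)) ≠ 0 := nonZeroDivisors.ne_zero C.2
  obtain ⟨z, hz, hzC⟩ : ∃ z : ℤ, 0 < z ∧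
      Ideal.span {(z : 𝓞 k)} * C = Ideal.span {x} * B.conjIdeal C := by
    refine ⟨m * Ideal.absNorm (C : Ideal (𝓞 k)), mul_pos hm (absNorm_pos C), ?_⟩
    rw [h, Int.cast_mul, ← Ideal.span_singleton_mul_span_singleton, ← B.mul_conjIdeal]
    ring
  have hzC' : Ideal.span {(z : 𝓞 k)} * B.conjIdeal C = Ideal.span {B.conjInt x} * C := by
    have := congrArg B.conjIdeal hzC
    rwa [B.conjIdeal_mul, B.conjIdeal_mul, B.conjIdeal_span_int, B.conjIdeal_span,
      B.conjIdeal_conjIdeal] at this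
  have hz0 := nonZeroDivisors.ne_zero (isTotPos_int (k := k) hz).span_mem
  obtain ⟨n, hn, hxn⟩ := hx.exists_norm_pos B
  have hzn : n = z ^ 2 := by
    apply B.eq_of_span_int_eq hn (pow_pos hz 2)
    apply mul_right_cancel₀ hC0
    calc Ideal.span {(n : 𝓞 k)} * C = Ideal.span {x} * (Ideal.span {B.conjInt x} * C) := by
          rw [← hxn, ← Ideal.span_singleton_mul_span_singleton, mul_assoc]
      _ = Ideal.span {(z : 𝓞 k)} * (Ideal.span {x} * B.conjIdeal C) := by rw [← hzC']; ring
      _ = Ideal.span {((z ^ 2 : ℤ) : 𝓞 k)} * C := by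
          rw [← hzC, Int.cast_pow, sq, ← Ideal.span_singleton_mul_span_singleton, mul_assoc]
  obtain ⟨β, hβ, hxβ⟩ := B.exists_isTotPos_mul_conjInt_eq hx hz
    (by rw [hxn, hzn, Int.cast_pow])
  set D : Ideal (𝓞 k) := Ideal.span {B.conjInt β} * C with hD
  have hDD : B.conjIdeal D = D := by
    apply mul_left_cancel₀ hz0
    rw [hD, B.conjIdeal_mul, B.conjIdeal_span, B.conjInt_conjInt]
    calc _ = Ideal.span {(z : 𝓞 k) * β} * B.conjIdeal C := by
          rw [← Ideal.span_singleton_mul_span_singleton, mul_assoc]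
      _ = Ideal.span {B.conjInt β} * (Ideal.span {x} * B.conjIdeal C) := by
          rw [← hxβ, ← Ideal.span_singleton_mul_span_singleton]; ring
      _ = _ := by rw [← hzC]; ring
  have hDmem : D ∈ (Ideal (𝓞 k))⁰ := mul_mem (hβ.conjInt B).span_mem C.2
  have hDpos : 0 < Ideal.absNorm D := by exact_mod_cast absNorm_pos ⟨D, hDmem⟩
  obtain ⟨a, e, ha, he, hae, hsq⟩ := Nat.sq_mul_squarefree_of_pos hDpos
  have hD2 : D ^ 2 = Ideal.span {(e : 𝓞 k)} ^ 2 * Ideal.span {(a : 𝓞 k)} := by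
    have := B.mul_conjIdeal D
    rw [hDD, ← sq, ← hae] at this
    rw [this, Ideal.span_singleton_pow, Ideal.span_singleton_mul_span_singleton]
    push_cast
    rfl
  have heT : IsTotPos (e : 𝓞 k) := by
    simpa using isTotPos_int (k := k) (m := e) (by exact_mod_cast he)
  have he0 := nonZeroDivisors.ne_zero heT.span_mem
  obtain ⟨I, hI⟩ : Ideal.span {(e : 𝓞 k)} ∣ D :=
    (UniqueFactorizationMonoid.pow_dvd_pow_iff_dvd two_ne_zero).mp ⟨_, hD2⟩
  have hI0 : I ∈ (Ideal (𝓞 k))⁰ := by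
    rw [mem_nonZeroDivisors_iff_ne_zero]
    rintro rfl
    rw [mul_zero] at hI
    exact nonZeroDivisors.ne_zero hDmem hI
  have hI2 : I ^ 2 = Ideal.span {((a : ℤ) : 𝓞 k)} := by
    apply mul_left_cancel₀ (pow_ne_zero 2 he0)
    rw [← mul_pow, ← hI, hD2, Int.cast_natCast]
  have hsq' : Squarefree (a : ℤ) := Int.squarefree_natCast.mpr hsq
  exact ⟨a, ⟨I, hI0⟩, ⟨by exact_mod_cast ha, hsq', B.dvd_disc_of_sq_eq hsq' hI2⟩, hI2,
    narrowClass_eq_of_mul_eq heT (hβ.conjInt B) hI.symm⟩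

end QuadraticBasis

/-! ### The exact sequence -/

/-- Two descendant indices in one square class coincide, so `cl` can be defined on classes. -/
theorem eq_of_sqClass_eq {a b : ℤ} (ha : Squarefree a) (hb : Squarefree b) (ha0 : a ≠ 0)
    (hb0 : b ≠ 0) (h : sqClass a ha0 = sqClass b hb0) : a = b := by
  obtain ⟨q, hq⟩ := QuotientGroup.eq.mp h
  rw [eq_inv_mul_iff_mul_eq] at hq
  have hq' : (a : ℚ) * (q : ℚ) ^ 2 = b := by simpa using congrArg Units.val hq
  obtain ⟨v, hv⟩ := ha.exists_int_of_mul_sq hq'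
  rw [hv] at hq'
  have h1 : a * v ^ 2 = b := by exact_mod_cast hq'
  have h2 := hb v ⟨a, by rw [← h1]; ring⟩
  rw [← h1, sq, Int.isUnit_mul_self h2, mul_one]

namespace QuadraticBasis

variable {k : Type*} [Field k] [NumberField k]

theorem narrowClass_sq_eq_one {I : (Ideal (𝓞 k))⁰} {a : ℤ} (ha : 0 < a)
    (hI : (I : Ideal (𝓞 k)) ^ 2 = Ideal.span {(a : 𝓞 k)}) : narrowClass k I ^ 2 = 1 := by
  rw [sq, ← narrowClass_mul]
  exact narrowClass_eq_one_of_span (isTotPos_int ha) (by rw [← hI, sq]; rfl)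

theorem narrowClass_mul_of_sq_eq {a b c g : ℤ} (hg : g ≠ 0) (h : a * b = c * g ^ 2)
    {I J K : (Ideal (𝓞 k))⁰} (hI : (I : Ideal (𝓞 k)) ^ 2 = Ideal.span {(a : 𝓞 k)})
    (hJ : (J : Ideal (𝓞 k)) ^ 2 = Ideal.span {(b : 𝓞 k)})
    (hK : (K : Ideal (𝓞 k)) ^ 2 = Ideal.span {(c : 𝓞 k)}) :
    narrowClass k K = narrowClass k I * narrowClass k J := by
  rw [← narrowClass_mul]
  -- Both `gK` and `IJ` have square `(ab)`, so they agree; `|g|` supplies a totally positive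
  -- generator of `(g)`.
  refine narrowClass_eq_of_mul_eq (isTotPos_int (abs_pos.mpr hg)) isTotPos_one ?_
  apply Ideal.eq_of_sq_eq_sq
  change _ = (Ideal.span {1} * ((I : Ideal (𝓞 k)) * (J : Ideal (𝓞 k)))) ^ 2
  rw [Ideal.span_singleton_one, Ideal.top_mul, mul_pow, mul_pow, hI, hJ, hK,
    Ideal.span_singleton_pow, Ideal.span_singleton_mul_span_singleton,
    Ideal.span_singleton_mul_span_singleton, ← Int.cast_pow, sq_abs, ← Int.cast_mul,
    ← Int.cast_mul, h, mul_comm]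

theorem existsUnique_isAmbiguous {d a : ℤ} (B : QuadraticBasis k (pellDisc d)) (hd : Squarefree d)
    (ha : IsDescendantIndex (pellDisc d) a) :
    ∃! I : (Ideal (𝓞 k))⁰, IsAmbiguous (I : Ideal (𝓞 k)) ∧
      ((Ideal.absNorm (I : Ideal (𝓞 k)) : ℕ) : ℤ) = a := by
  obtain ⟨I, hI⟩ := B.exists_sq_eq hd ha
  refine ⟨I, ⟨isAmbiguous_of_sq_eq hI, B.absNorm_of_sq_eq ha.pos hI⟩, ?_⟩
  rintro J ⟨hJ, hJn⟩
  exact Subtype.ext (Ideal.eq_of_sq_eq_sq ((B.sq_eq_of_isAmbiguous hJ hJn).trans hI.symm))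

/-- The homomorphism from the Selmer group to the narrow class group that sends the class of `a`
to the class of the ideal with square `(a)`. -/
theorem exists_selmer_hom {d : ℤ} (B : QuadraticBasis k (pellDisc d)) (hd : Squarefree d) :
    ∃ cl : pellSelmer (pellDisc d) →* narrowSquaresTwoTorsion k,
      ∀ (a : ℤ) (ha : IsDescendantIndex (pellDisc d) a)
        (hSel : sqClass a ha.pos.ne' ∈ pellSelmer (pellDisc d)) (I : (Ideal (𝓞 k))⁰),
        (I : Ideal (𝓞 k)) ^ 2 = Ideal.span {(a : 𝓞 k)} →
        (cl ⟨sqClass a ha.pos.ne', hSel⟩ : NarrowClassGroup k) = narrowClass k I := by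
  have hex : ∀ s : pellSelmer (pellDisc d), ∃ (a : ℤ) (ha : IsDescendantIndex (pellDisc d) a)
      (I : (Ideal (𝓞 k))⁰), (s : RatSquareClass) = sqClass a ha.pos.ne' ∧
      (descendantPoints (pellDisc d) a ℚ).Nonempty ∧
      (I : Ideal (𝓞 k)) ^ 2 = Ideal.span {(a : 𝓞 k)} := by
    rintro ⟨s, a, ha, hs, hp⟩
    obtain ⟨I, hI⟩ := B.exists_sq_eq hd ha
    exact ⟨a, ha, I, hs, hp, hI⟩
  -- The choices are forced: the class determines `a`, and `I² = (a)` determines `I`.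
  choose a ha I hs hp hI using hex
  refine ⟨MonoidHom.mk' (fun s => ⟨narrowClass k (I s), ?_, ?_⟩) ?_, ?_⟩
  · obtain ⟨c, hc⟩ := B.exists_narrowClass_eq_sq_of_point (ha s) (hI s) (hp s)
    exact ⟨c, hc.symm⟩
  · exact narrowClass_sq_eq_one (ha s).pos (hI s)
  · intro s s'
    apply Subtype.ext
    obtain ⟨g, u, v, l, hu, hv, -, hg, huv, -⟩ := (ha s).exists_mul (ha s')
    have hprod : a s * a s' = u * v * g ^ 2 := by rw [hu, hv]; ring
    refine narrowClass_mul_of_sq_eq hg ?_ (hI s) (hI s') (hI (s * s'))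
    rw [hprod]
    congr 1
    refine eq_of_sqClass_eq huv.squarefree (ha (s * s')).squarefree huv.pos.ne'
      (ha (s * s')).pos.ne' ?_
    rw [← hs, Subgroup.coe_mul, hs, hs]
    exact (sqClass_mul_eq (ha s).pos.ne' (ha s').pos.ne' huv.pos.ne' hg hprod).symm
  · intro b hb hSel J hJ
    set s : pellSelmer (pellDisc d) := ⟨_, hSel⟩
    have hab : b = a s := eq_of_sqClass_eq hb.squarefree (ha s).squarefree hb.pos.ne'
      (ha s).pos.ne' (hs s)
    change narrowClass k (I s) = _
    congr 1
    exact Subtype.ext (Ideal.eq_of_sq_eq_sq (by rw [hI, hJ, hab]))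

end QuadraticBasis

theorem mainTheorem7 (d : ℤ) (hd : Squarefree d) (hd1 : d ≠ 1)
    (k : Type*) [Field k] [NumberField k] (hk : Module.finrank ℚ k = 2)
    (hsqrt : ∃ δ : k, δ ^ 2 = ((pellDisc d : ℤ) : k)) :
    (∀ a : ℤ, IsDescendantIndex (pellDisc d) a →
      ∃! I : (Ideal (𝓞 k))⁰, IsAmbiguous (I : Ideal (𝓞 k)) ∧
        ((Ideal.absNorm (I : Ideal (𝓞 k)) : ℕ) : ℤ) = a) ∧
    ∃ cl : pellSelmer (pellDisc d) →* narrowSquaresTwoTorsion k,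
      (∀ (a : ℤ) (ha : IsDescendantIndex (pellDisc d) a)
        (hSel : sqClass a ha.pos.ne' ∈ pellSelmer (pellDisc d)) (I : (Ideal (𝓞 k))⁰),
        IsAmbiguous (I : Ideal (𝓞 k)) →
        ((Ideal.absNorm (I : Ideal (𝓞 k)) : ℕ) : ℤ) = a →
        (cl ⟨sqClass a ha.pos.ne', hSel⟩ : NarrowClassGroup k) = narrowClass k I) ∧
      Function.Injective (Subgroup.inclusion (pellW_le_pellSelmer (pellDisc d))) ∧
      Function.MulExact (Subgroup.inclusion (pellW_le_pellSelmer (pellDisc d))) cl ∧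
      Function.Surjective cl ∧
      ∃ e : PellSha (pellDisc d) ≃* narrowSquaresTwoTorsion k,
        ∀ x : pellSelmer (pellDisc d), e (QuotientGroup.mk x) = cl x := by

  obtain ⟨δ, hδ⟩ := hsqrt
  obtain ⟨B⟩ := exists_quadraticBasis hd hd1 hk hδ
  refine ⟨fun a ha => B.existsUnique_isAmbiguous hd ha, ?_⟩
  obtain ⟨cl, hcl⟩ := B.exists_selmer_hom hd
  have hker : (pellW (pellDisc d)).subgroupOf (pellSelmer (pellDisc d)) = cl.ker := by
    ext ⟨s, hs⟩
    have hs' := hs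
    obtain ⟨a, ha, rfl, -⟩ := hs'
    obtain ⟨I, hI⟩ := B.exists_sq_eq hd ha
    rw [Subgroup.mem_subgroupOf, MonoidHom.mem_ker, ← Subtype.coe_inj, hcl a ha _ I hI,
      OneMemClass.coe_one]
    constructor
    · rintro ⟨b, hb, hab, hbp⟩
      obtain rfl := eq_of_sqClass_eq ha.squarefree hb.squarefree ha.pos.ne' hb.pos.ne' hab
      exact B.narrowClass_eq_one_of_integral_point ha hI hbp
    · intro h
      exact ⟨a, ha, rfl, B.integral_point_of_narrowClass_eq_one ha hI h⟩
  have hsurj : Function.Surjective cl := by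
    rintro ⟨c, ⟨e, he⟩, hc⟩
    -- That `c` is 2-torsion provides `a` and `I`; that `c` is a square puts a rational point on
    -- `T_a`.
    obtain ⟨a, I, ha, hI, rfl⟩ := B.exists_sq_eq_of_narrowClass_sq_eq_one hc
    have hp := B.point_of_narrowClass_eq_sq ha hI he.symm
    exact ⟨⟨sqClass a ha.pos.ne', a, ha, rfl, hp⟩, Subtype.ext (hcl a ha _ I hI)⟩
  refine ⟨cl, fun a ha hSel I hI hIn => hcl a ha hSel I (B.sq_eq_of_isAmbiguous hI hIn),
    Subgroup.inclusion_injective _, fun s => ?_, hsurj,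
    (QuotientGroup.quotientMulEquivOfEq hker).trans
      (QuotientGroup.quotientKerEquivOfSurjective cl hsurj), fun x => rfl⟩
  rw [← MonoidHom.mem_ker, ← hker, Subgroup.mem_subgroupOf]
  exact ⟨fun h => ⟨⟨s, h⟩, rfl⟩, by rintro ⟨w, rfl⟩; exact w.2⟩
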